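/- **Setting.** Let $n\ge 0$, $m\ge 1$ and $N=4m$. Let $\mathfrak h_n=\{Z=X+iY\in M_{n\times n}(\mathbb C) : {}^tZ=Z,\ Y>0\}$ be the Siegel upper half space, on which $\mathrm{Sp}(2n,\mathbb R)$ acts by $\left(\begin{smallmatrix}A&B\\C&D\end{smallmatrix}\right)\cdot Z=(AZ+B)(CZ+D)^{-1}$. Let $\Gamma(N)=\{\gamma\in \mathrm{Sp}(2n,\mathbb Z):\gamma\equiv I \bmod N\}$ and $X=\Gamma(N)\backslash\mathfrak h_n$. The involution $\tau(Z)=-\overline Z$ of $\mathfrak h_n$ descends to $X$; let $X_{\mathbb R}\subset X$ be its set of fixed points (the real points of $X$). **Real abelian varieties.** A *principally polarized abelian variety* is a pair $(A=\mathbb C^n/L,\,H=R+iQ)$, where $L\subset\mathbb C^n$ is a lattice and $H$ is a positive definite Hermitian form (linear in the first variable) such that $L$ has a symplectic basis, i.e. a $\mathbb Z$-basis $\{u_i,v_j\}_{1\le i,j\le n}$ in which $Q=\operatorname{Im}H$ has matrix $\left(\begin{smallmatrix}0&I\\-I&0\end{smallmatrix}\right)$. A *compatible real structure* is a complex anti-linear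 involution $\kappa$ of $\mathbb C^n$ with $\kappa(L)=L$ and $Q(\kappa u,\kappa v)=-Q(u,v)$. A *level $N$ structure* is a basis $\{U_i,V_j\}$ of the $N$-torsion of $A$ which has a lift, i.e. a symplectic basis $\{u_i,v_j\}$ of $L$ with $U_i\equiv u_i/N$, $V_j\equiv v_j/N \bmod L$; it is *compatible* with $\kappa$ if $\kappa(u_i/N)\equiv -u_i/N$ and $\kappa(v_j/N)\equiv v_j/N \bmod L$ for some lift. A *real principally polarized abelian variety with level $N$ structure* is a quadruple $(A,H,\kappa,\{U_i,V_j\})$ of this kind, with compatible level structure. An *isomorphism* from it to $(A',H',\kappa',\{U'_i,V'_j\})$ is an invertible complex linear map $\phi:\mathbb C^n\to\mathbb C^n$ with $\phi(L)=L'$, $\phi_*H=H'$, $\phi\kappa\phi^{-1}=\kappa'$, and $\phi(u_i/N)\equiv u_i'/N$, $\phi(v_j/N)\equiv v_j'/N \bmod L'$ for some lifts. **The quadruple $\mathcal A_Z$.** For $Z\in\mathfrak h_n$ put $F_Z(x,y)=Zx+y$ for $x,y\in\mathbb R^n$, $L_Z=F_Z(\mathbb Z^n\oplus\mathbb Z^n)$,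 $A_Z=\mathbb C^n/L_Z$, and $H_Z(u,v)={}^tu\,(\operatorname{Im}Z)^{-1}\,\overline v$. The standard level $N$ structure is $\{F_Z(e_i/N),F_Z(f_j/N)\} \bmod L_Z$, where $\{e_i,f_j\}$ is the standard basis of $\mathbb R^n\oplus\mathbb R^n$. **Theorem.** 1. If the class $[Z]\in X$ of $Z\in\mathfrak h_n$ lies in $X_{\mathbb R}$, then there is a unique $\gamma=\left(\begin{smallmatrix}A&B\\C&D\end{smallmatrix}\right)\in\Gamma(N)$ with $\gamma\cdot Z=-\overline Z$. Put $\kappa_Z(M)={}^t(CZ+D)\,\overline M$ for $M\in\mathbb C^n$. 2. For such $Z$, the quadruple $\mathcal A_Z=(A_Z,H_Z,\kappa_Z,\{F_Z(e_i/N),F_Z(f_j/N)\})$ is a real principally polarized abelian variety with level $N$ structure. 3. The association $[Z]\mapsto[\mathcal A_Z]$ is a well-defined bijection from $X_{\mathbb R}$ onto the set of isomorphism classes of $n$-dimensional real principally polarized abelian varieties with level $N$ structure. -/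

import Mathlib

open Matrix

namespace RealAV

noncomputable section

/-! # The Siegel upper half space and its modular quotient -/

/-- The Siegel upper half space `𝔥ₙ`: symmetric complex matrices with positive definite
imaginary part. -/
@[ext]
structure SiegelSpace (n : ℕ) where
  /-- The underlying matrix. -/
  mat : Matrix (Fin n) (Fin n) ℂ
  symm : matᵀ = mat
  im_posDef : (mat.map Complex.im).PosDef

/-- `Sp(2n, R)`. -/
abbrev Sp (n : ℕ) (R : Type) [CommRing R] : Type := symplecticGroup (Fin n) R

section Blocks

variable {n : ℕ} {R : Type} [CommRing R]

/-- The blocks of `g = (A B; C D)`. -/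
abbrev blockA (g : Sp n R) : Matrix (Fin n) (Fin n) R := g.1.toBlocks₁₁
/-- The upper right block. -/
abbrev blockB (g : Sp n R) : Matrix (Fin n) (Fin n) R := g.1.toBlocks₁₂
/-- The lower left block. -/
abbrev blockC (g : Sp n R) : Matrix (Fin n) (Fin n) R := g.1.toBlocks₂₁
/-- The lower right block. -/
abbrev blockD (g : Sp n R) : Matrix (Fin n) (Fin n) R := g.1.toBlocks₂₂

/-- Base change `Sp(2n, R) → Sp(2n, S)` along a ring homomorphism. -/
def spMap {S : Type} [CommRing S] (f : R →+* S) : Sp n R →* Sp n S where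
  toFun g := ⟨g.1.map f, SymplecticGroup.map_mem g.2 f⟩
  map_one' := by
    apply Subtype.ext
    simp
  map_mul' g h := by
    apply Subtype.ext
    simp [Matrix.map_mul]

theorem block_relations (g : Sp n R) :
    (blockA g)ᵀ * blockC g = (blockC g)ᵀ * blockA g ∧
    (blockB g)ᵀ * blockD g = (blockD g)ᵀ * blockB g ∧
    (blockA g)ᵀ * blockD g - (blockC g)ᵀ * blockB g = 1 := by
  rw [← SymplecticGroup.fromBlocks_mem_iff, fromBlocks_toBlocks]
  exact g.2

theorem mul_blocks (g h : Sp n R) :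
    blockA (g * h) = blockA g * blockA h + blockB g * blockC h ∧
    blockB (g * h) = blockA g * blockB h + blockB g * blockD h ∧
    blockC (g * h) = blockC g * blockA h + blockD g * blockC h ∧
    blockD (g * h) = blockC g * blockB h + blockD g * blockD h := by
  have key : (g * h).1 = fromBlocks (blockA g) (blockB g) (blockC g) (blockD g) *
      fromBlocks (blockA h) (blockB h) (blockC h) (blockD h) := by
    rw [fromBlocks_toBlocks, fromBlocks_toBlocks]; rfl
  rw [fromBlocks_multiply] at key
  simp only [blockA, blockB, blockC, blockD, key, toBlocks_fromBlocks₁₁, toBlocks_fromBlocks₁₂,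
    toBlocks_fromBlocks₂₁, toBlocks_fromBlocks₂₂, and_self]

theorem spTau_mem (g : Sp n R) :
    fromBlocks (blockA g) (-blockB g) (-blockC g) (blockD g) ∈ symplecticGroup (Fin n) R := by
  obtain ⟨h1, h2, h3⟩ := block_relations g
  rw [SymplecticGroup.fromBlocks_mem_iff]
  refine ⟨?_, ?_, ?_⟩
  · simp [h1]
  · simp [h2]
  · simpa using h3

/-- The involution `τ (A B; C D) = (A -B; -C D)` of `Sp(2n)`. -/
def spTau (g : Sp n R) : Sp n R :=
  ⟨fromBlocks (blockA g) (-blockB g) (-blockC g) (blockD g), spTau_mem g⟩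

end Blocks

/-- The inclusion `Sp(2n, ℝ) → Sp(2n, ℂ)`. -/
abbrev toC {n : ℕ} (g : Sp n ℝ) : Sp n ℂ := spMap Complex.ofRealHom g

section Action

open scoped ComplexOrder

variable {n : ℕ}

/-- The automorphy numerator `A Z + B`. -/
def num (g : Sp n ℝ) (Z : Matrix (Fin n) (Fin n) ℂ) : Matrix (Fin n) (Fin n) ℂ :=
  blockA (toC g) * Z + blockB (toC g)

/-- The automorphy denominator `C Z + D`. -/
def denom (g : Sp n ℝ) (Z : Matrix (Fin n) (Fin n) ℂ) : Matrix (Fin n) (Fin n) ℂ :=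
  blockC (toC g) * Z + blockD (toC g)

theorem conj_blocks (g : Sp n ℝ) :
    (blockA (toC g))ᴴ = (blockA (toC g))ᵀ ∧ (blockB (toC g))ᴴ = (blockB (toC g))ᵀ ∧
    (blockC (toC g))ᴴ = (blockC (toC g))ᵀ ∧ (blockD (toC g))ᴴ = (blockD (toC g))ᵀ := by
  refine ⟨?_, ?_, ?_, ?_⟩ <;> ext i j <;> exact Complex.conj_ofReal _

theorem num_transpose_mul_denom (g : Sp n ℝ) {Z : Matrix (Fin n) (Fin n) ℂ} (hZ : Zᵀ = Z) :
    (num g Z)ᵀ * denom g Z = (denom g Z)ᵀ * num g Z := by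
  obtain ⟨h1, h2, h3⟩ := block_relations (toC g)
  have h4 := congrArg Matrix.transpose h3
  simp only [transpose_sub, transpose_mul, transpose_transpose, transpose_one] at h4
  simp only [num, denom, transpose_add, transpose_mul, hZ]
  generalize blockA (toC g) = A at *
  generalize blockB (toC g) = B at *
  generalize blockC (toC g) = C at *
  generalize blockD (toC g) = D at *
  calc (Z * Aᵀ + Bᵀ) * (C * Z + D)
      = Z * (Aᵀ * C) * Z + Z * (Aᵀ * D) + Bᵀ * C * Z + Bᵀ * D := by noncomm_ring
    _ = Z * (Cᵀ * A) * Z + Z * (1 + Cᵀ * B) + (Dᵀ * A - 1) * Z + Dᵀ * B := by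
        rw [h1, h2, sub_eq_iff_eq_add.1 h3, ← h4]; noncomm_ring
    _ = (Z * Cᵀ + Dᵀ) * (A * Z + B) := by noncomm_ring

theorem num_star_mul_denom (g : Sp n ℝ) {Z : Matrix (Fin n) (Fin n) ℂ} :
    (num g Z)ᴴ * denom g Z - (denom g Z)ᴴ * num g Z = Zᴴ - Z := by
  obtain ⟨h1, h2, h3⟩ := block_relations (toC g)
  obtain ⟨a, b, c, d⟩ := conj_blocks g
  have h4 := congrArg Matrix.transpose h3
  simp only [transpose_sub, transpose_mul, transpose_transpose, transpose_one] at h4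
  simp only [num, denom, conjTranspose_add, conjTranspose_mul, a, b, c, d]
  generalize blockA (toC g) = A at *
  generalize blockB (toC g) = B at *
  generalize blockC (toC g) = C at *
  generalize blockD (toC g) = D at *
  calc (Zᴴ * Aᵀ + Bᵀ) * (C * Z + D) - (Zᴴ * Cᵀ + Dᵀ) * (A * Z + B)
      = Zᴴ * (Aᵀ * C - Cᵀ * A) * Z + Zᴴ * (Aᵀ * D - Cᵀ * B) - (Dᵀ * A - Bᵀ * C) * Z
          + (Bᵀ * D - Dᵀ * B) := by noncomm_ring
    _ = Zᴴ - Z := by rw [h1, h2, h3, h4]; noncomm_ring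

theorem conjTranspose_sub_self {Z : Matrix (Fin n) (Fin n) ℂ} (hZ : Zᵀ = Z) :
    Zᴴ - Z = (-2 * Complex.I) • (Z.map Complex.im).map Complex.ofReal := by
  ext i j
  have h : Z j i = Z i j := congrFun (congrFun hZ i) j
  apply Complex.ext <;> simp [h]
  ring

theorem posDef_ofReal_iff {Y : Matrix (Fin n) (Fin n) ℝ} :
    (Y.map Complex.ofReal).PosDef ↔ Y.PosDef := by
  constructor
  · intro h
    refine PosDef.of_dotProduct_mulVec_pos ?_ ?_
    · ext i j
      have := congrFun (congrFun h.1 i) j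
      simpa using this
    · intro x hx
      have hx' : (fun i => (x i : ℂ)) ≠ 0 := by
        intro h0
        apply hx
        ext i
        simpa using congrFun h0 i
      have := h.dotProduct_mulVec_pos hx'
      have e : star (fun i => (x i : ℂ)) ⬝ᵥ (Y.map Complex.ofReal *ᵥ fun i => (x i : ℂ))
          = ((star x ⬝ᵥ (Y *ᵥ x) : ℝ) : ℂ) := by
        simp [dotProduct, mulVec]
      rw [e] at this
      exact_mod_cast this
  · intro h
    have hs : ∀ i j, Y j i = Y i j := fun i j => by simpa using congrFun (congrFun h.1 i) j
    refine PosDef.of_dotProduct_mulVec_pos ?_ ?_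
    · ext i j
      simp [hs]
    · intro x hx
      set a : Fin n → ℝ := fun i => (x i).re with ha
      set b : Fin n → ℝ := fun i => (x i).im with hb
      have hsym : a ⬝ᵥ (Y *ᵥ b) = b ⬝ᵥ (Y *ᵥ a) := by
        simp only [dotProduct, mulVec, Finset.mul_sum]
        rw [Finset.sum_comm]
        refine Finset.sum_congr rfl fun i _ => Finset.sum_congr rfl fun j _ => ?_
        rw [hs i j]; ring
      have e : star x ⬝ᵥ (Y.map Complex.ofReal *ᵥ x)
          = ((a ⬝ᵥ (Y *ᵥ a) + b ⬝ᵥ (Y *ᵥ b) : ℝ) : ℂ) := by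
        apply Complex.ext
        · simp [dotProduct, mulVec, ha, hb, Finset.sum_add_distrib]
        · have : b ⬝ᵥ (Y *ᵥ a) = a ⬝ᵥ (Y *ᵥ b) := hsym.symm
          simp only [dotProduct, mulVec, ha, hb] at this
          simp [dotProduct, mulVec, Finset.sum_add_distrib, this]
      rw [e]
      have hnn : ∀ c : Fin n → ℝ, 0 ≤ c ⬝ᵥ (Y *ᵥ c) := fun c => by
        simpa using h.posSemidef.dotProduct_mulVec_nonneg c
      have hpos : ∀ c : Fin n → ℝ, c ≠ 0 → 0 < c ⬝ᵥ (Y *ᵥ c) := fun c hc => by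
        simpa using h.dotProduct_mulVec_pos hc
      have : 0 < a ⬝ᵥ (Y *ᵥ a) + b ⬝ᵥ (Y *ᵥ b) := by
        by_cases h0 : a = 0
        · have hb0 : b ≠ 0 := by
            intro hb0
            apply hx
            ext i
            exact Complex.ext (congrFun h0 i) (congrFun hb0 i)
          have := hpos b hb0
          have := hnn a
          linarith
        · have := hpos a h0
          have := hnn b
          linarith
      exact_mod_cast this

theorem isUnit_denom (g : Sp n ℝ) (Z : SiegelSpace n) : IsUnit (denom g Z.mat) := by
  rw [Matrix.isUnit_iff_isUnit_det, isUnit_iff_ne_zero]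
  intro hdet
  obtain ⟨v, hv, hv0⟩ := Matrix.exists_mulVec_eq_zero_iff.2 hdet
  have h := congrArg (fun M => star v ⬝ᵥ (M *ᵥ v)) (num_star_mul_denom g (Z := Z.mat))
  rw [conjTranspose_sub_self Z.symm] at h
  have e : star v ⬝ᵥ ((denom g Z.mat)ᴴ *ᵥ (num g Z.mat *ᵥ v)) = 0 := by
    rw [dotProduct_mulVec, ← star_mulVec, hv0]
    simp
  simp only [sub_mulVec, ← mulVec_mulVec, hv0, mulVec_zero, dotProduct_sub, dotProduct_zero, e,
    sub_zero, smul_mulVec, dotProduct_smul] at h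
  have hp := (posDef_ofReal_iff.2 Z.im_posDef).dotProduct_mulVec_pos hv
  have h2 : (-2 * Complex.I) ≠ 0 := by simp
  rcases smul_eq_zero.1 h.symm with h3 | h3
  · exact h2 h3
  · exact hp.ne' h3

theorem smul_symm (g : Sp n ℝ) (Z : SiegelSpace n) :
    (num g Z.mat * (denom g Z.mat)⁻¹)ᵀ = num g Z.mat * (denom g Z.mat)⁻¹ := by
  have hu := (Matrix.isUnit_iff_isUnit_det _).1 (isUnit_denom g Z)
  have hu' : IsUnit ((denom g Z.mat)ᵀ).det := by rwa [det_transpose]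
  rw [transpose_mul, transpose_nonsing_inv]
  calc ((denom g Z.mat)ᵀ)⁻¹ * (num g Z.mat)ᵀ
      = ((denom g Z.mat)ᵀ)⁻¹ * ((num g Z.mat)ᵀ * denom g Z.mat) * (denom g Z.mat)⁻¹ := by
        rw [Matrix.mul_assoc, mul_nonsing_inv_cancel_right _ _ hu]
    _ = num g Z.mat * (denom g Z.mat)⁻¹ := by
        rw [num_transpose_mul_denom g Z.symm, nonsing_inv_mul_cancel_left _ _ hu']

theorem smul_posDef (g : Sp n ℝ) (Z : SiegelSpace n) :
    ((num g Z.mat * (denom g Z.mat)⁻¹).map Complex.im).PosDef := by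
  have hU := isUnit_denom g Z
  have hu := (Matrix.isUnit_iff_isUnit_det _).1 hU
  have hu' : IsUnit ((denom g Z.mat)ᴴ).det := by rw [det_conjTranspose]; exact hu.star
  rw [← posDef_ofReal_iff]
  have h1 := conjTranspose_sub_self (smul_symm g Z)
  have h2 : (num g Z.mat * (denom g Z.mat)⁻¹)ᴴ - num g Z.mat * (denom g Z.mat)⁻¹
      = ((denom g Z.mat)⁻¹)ᴴ * (Z.matᴴ - Z.mat) * (denom g Z.mat)⁻¹ := by
    rw [← num_star_mul_denom g (Z := Z.mat), conjTranspose_mul, Matrix.mul_sub, Matrix.sub_mul,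
      conjTranspose_nonsing_inv, nonsing_inv_mul_cancel_left _ _ hu', ← Matrix.mul_assoc,
      mul_nonsing_inv_cancel_right _ _ hu]
  rw [h1, conjTranspose_sub_self Z.symm, Matrix.mul_smul, Matrix.smul_mul] at h2
  rw [smul_right_injective _ (show (-2 * Complex.I) ≠ 0 by simp) h2]
  refine (posDef_ofReal_iff.2 Z.im_posDef).conjTranspose_mul_mul_same ?_
  rw [Matrix.mulVec_injective_iff_isUnit]
  exact (Matrix.isUnit_nonsing_inv_iff).2 hU

theorem num_mul (g h : Sp n ℝ) (Z : SiegelSpace n) :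
    num (g * h) Z.mat = num g (num h Z.mat * (denom h Z.mat)⁻¹) * denom h Z.mat := by
  have hu := (Matrix.isUnit_iff_isUnit_det _).1 (isUnit_denom h Z)
  obtain ⟨a, b, -, -⟩ := mul_blocks (toC g) (toC h)
  have e : num g (num h Z.mat * (denom h Z.mat)⁻¹) * denom h Z.mat
      = blockA (toC g) * num h Z.mat + blockB (toC g) * denom h Z.mat := by
    rw [num, Matrix.add_mul, Matrix.mul_assoc, nonsing_inv_mul_cancel_right _ _ hu]
  have em : toC (g * h) = toC g * toC h := map_mul (spMap Complex.ofRealHom) g h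
  rw [e, num, em, a, b, num, denom]
  noncomm_ring

theorem denom_mul (g h : Sp n ℝ) (Z : SiegelSpace n) :
    denom (g * h) Z.mat = denom g (num h Z.mat * (denom h Z.mat)⁻¹) * denom h Z.mat := by
  have hu := (Matrix.isUnit_iff_isUnit_det _).1 (isUnit_denom h Z)
  obtain ⟨-, -, c, d⟩ := mul_blocks (toC g) (toC h)
  have e : denom g (num h Z.mat * (denom h Z.mat)⁻¹) * denom h Z.mat
      = blockC (toC g) * num h Z.mat + blockD (toC g) * denom h Z.mat := by
    rw [denom, Matrix.add_mul, Matrix.mul_assoc, nonsing_inv_mul_cancel_right _ _ hu]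
  have em : toC (g * h) = toC g * toC h := map_mul (spMap Complex.ofRealHom) g h
  rw [e, denom, em, c, d, num, denom]
  noncomm_ring

/-- `Sp(2n, ℝ)` acts on `𝔥ₙ` by `g • Z = (A Z + B) (C Z + D)⁻¹`. -/
instance : MulAction (Sp n ℝ) (SiegelSpace n) where
  smul g Z := ⟨num g Z.mat * (denom g Z.mat)⁻¹, smul_symm g Z, smul_posDef g Z⟩
  one_smul Z := by
    apply SiegelSpace.ext
    change num 1 Z.mat * (denom 1 Z.mat)⁻¹ = Z.mat
    have e1 : toC (1 : Sp n ℝ) = 1 := map_one (spMap Complex.ofRealHom)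
    have h1 : (1 : Sp n ℂ).1 = fromBlocks 1 0 0 1 := by
      rw [fromBlocks_one]; rfl
    simp only [num, denom, blockA, blockB, blockC, blockD, e1, h1, toBlocks_fromBlocks₁₁,
      toBlocks_fromBlocks₁₂, toBlocks_fromBlocks₂₁, toBlocks_fromBlocks₂₂]
    simp
  mul_smul g h Z := by
    apply SiegelSpace.ext
    change num (g * h) Z.mat * (denom (g * h) Z.mat)⁻¹ =
      num g (num h Z.mat * (denom h Z.mat)⁻¹) * (denom g (num h Z.mat * (denom h Z.mat)⁻¹))⁻¹
    have hu := (Matrix.isUnit_iff_isUnit_det _).1 (isUnit_denom h Z)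
    rw [num_mul, denom_mul, Matrix.mul_inv_rev, Matrix.mul_assoc,
      mul_nonsing_inv_cancel_left _ _ hu]

theorem smul_mat (g : Sp n ℝ) (Z : SiegelSpace n) :
    (g • Z).mat = num g Z.mat * (denom g Z.mat)⁻¹ := rfl

/-- `Sp(2n, ℤ)` acts on `𝔥ₙ` through `Sp(2n, ℝ)`. -/
instance : MulAction (Sp n ℤ) (SiegelSpace n) :=
  MulAction.compHom (SiegelSpace n) (spMap (Int.castRingHom ℝ))

theorem int_smul_def (g : Sp n ℤ) (Z : SiegelSpace n) :
    g • Z = spMap (Int.castRingHom ℝ) g • Z := rfl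

/-- The anti-holomorphic involution `τ Z = - Z̄` of `𝔥ₙ`. -/
def tau (Z : SiegelSpace n) : SiegelSpace n where
  mat := -Z.mat.map (starRingEnd ℂ)
  symm := by
    rw [transpose_neg, ← transpose_map, Z.symm]
  im_posDef := by
    have : (-Z.mat.map (starRingEnd ℂ)).map Complex.im = Z.mat.map Complex.im := by
      ext i j
      simp
    rw [this]
    exact Z.im_posDef

end Action

section Quotient

/-- The principal congruence subgroup `Γ(N)` of level `N` in `Sp(2n, ℤ)`. -/
def Gam (n N : ℕ) : Subgroup (Sp n ℤ) :=
  (spMap (n := n) (Int.castRingHom (ZMod N))).ker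

variable {n : ℕ}

theorem spMap_spTau {R S : Type} [CommRing R] [CommRing S] (f : R →+* S) (g : Sp n R) :
    spMap f (spTau g) = spTau (spMap f g) := by
  apply Subtype.ext
  ext i j
  rcases i with i | i <;> rcases j with j | j
  · rfl
  · exact map_neg f _
  · exact map_neg f _
  · rfl

theorem blocks_map_conj (g : Sp n ℝ) :
    (blockA (toC g)).map (starRingEnd ℂ) = blockA (toC g) ∧
    (blockB (toC g)).map (starRingEnd ℂ) = blockB (toC g) ∧
    (blockC (toC g)).map (starRingEnd ℂ) = blockC (toC g) ∧
    (blockD (toC g)).map (starRingEnd ℂ) = blockD (toC g) := by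
  refine ⟨?_, ?_, ?_, ?_⟩ <;> ext i j <;> exact Complex.conj_ofReal _

theorem blocks_spTau {R : Type} [CommRing R] (g : Sp n R) :
    blockA (spTau g) = blockA g ∧ blockB (spTau g) = -blockB g ∧
    blockC (spTau g) = -blockC g ∧ blockD (spTau g) = blockD g :=
  ⟨rfl, rfl, rfl, rfl⟩

theorem tau_smul (g : Sp n ℤ) (Z : SiegelSpace n) : tau (g • Z) = spTau g • tau Z := by
  apply SiegelSpace.ext
  have key : ∀ M : Matrix (Fin n) (Fin n) ℂ, IsUnit M.det →
      (M⁻¹).map (starRingEnd ℂ) = (M.map (starRingEnd ℂ))⁻¹ := by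
    intro M hM
    symm
    apply Matrix.inv_eq_right_inv
    rw [← Matrix.map_mul, Matrix.mul_nonsing_inv _ hM]
    simp
  have hadd : ∀ M M' : Matrix (Fin n) (Fin n) ℂ, (M + M').map (starRingEnd ℂ) =
      M.map (starRingEnd ℂ) + M'.map (starRingEnd ℂ) := fun M M' => by
    ext i j
    simp
  have hu := (Matrix.isUnit_iff_isUnit_det _).1 (isUnit_denom (spMap (Int.castRingHom ℝ) g) Z)
  obtain ⟨a, b, c, d⟩ := blocks_map_conj (spMap (Int.castRingHom ℝ) g)
  obtain ⟨a', b', c', d'⟩ := blocks_spTau (toC (spMap (Int.castRingHom ℝ) g))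
  have hn : num (spMap (Int.castRingHom ℝ) (spTau g)) (tau Z).mat
      = -(num (spMap (Int.castRingHom ℝ) g) Z.mat).map (starRingEnd ℂ) := by
    rw [num, num, toC, spMap_spTau, spMap_spTau, a', b', hadd, Matrix.map_mul, a, b, tau]
    simp only [Matrix.mul_neg, neg_add]
  have hd : denom (spMap (Int.castRingHom ℝ) (spTau g)) (tau Z).mat
      = (denom (spMap (Int.castRingHom ℝ) g) Z.mat).map (starRingEnd ℂ) := by
    rw [denom, denom, toC, spMap_spTau, spMap_spTau, c', d', hadd, Matrix.map_mul, c, d, tau]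
    simp only [Matrix.neg_mul, Matrix.mul_neg, neg_neg]
  change -((num (spMap (Int.castRingHom ℝ) g) Z.mat *
    (denom (spMap (Int.castRingHom ℝ) g) Z.mat)⁻¹).map (starRingEnd ℂ)) = _
  rw [int_smul_def, smul_mat, hn, hd, Matrix.map_mul, key _ hu, Matrix.neg_mul]

theorem spTau_mem_Gam {N : ℕ} {g : Sp n ℤ} (hg : g ∈ Gam n N) : spTau g ∈ Gam n N := by
  rw [Gam, MonoidHom.mem_ker] at hg ⊢
  rw [spMap_spTau, hg]
  apply Subtype.ext
  have h1 : (1 : Sp n (ZMod N)).1 = fromBlocks 1 0 0 1 := by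
    rw [fromBlocks_one]; rfl
  simp only [spTau, blockA, blockB, blockC, blockD, h1, toBlocks_fromBlocks₁₁,
      toBlocks_fromBlocks₁₂, toBlocks_fromBlocks₂₁, toBlocks_fromBlocks₂₂, neg_zero]

/-- The quotient `X = Γ(N) \ 𝔥ₙ`. -/
abbrev X (n N : ℕ) : Type := MulAction.orbitRel.Quotient (Gam n N) (SiegelSpace n)

/-- The class `[Z] ∈ X` of a point `Z ∈ 𝔥ₙ`. -/
def toX (N : ℕ) (Z : SiegelSpace n) : X n N := Quotient.mk _ Z

/-- The involution of `X` induced by `τ Z = - Z̄`: `τ [Z] = [τ Z]`. -/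
def tauX (n N : ℕ) : X n N → X n N :=
  Quotient.map tau (by
    rintro _ Z ⟨g, rfl⟩
    exact ⟨⟨spTau g.1, spTau_mem_Gam g.2⟩, (tau_smul g.1 Z).symm⟩)

/-- The set `X_ℝ` of real points of `X`: the fixed points of the induced involution. -/
def XR (n N : ℕ) : Set (X n N) := {x | tauX n N x = x}

end Quotient

/-! # Real principally polarized abelian varieties with level structure -/

/-- The raw data of a quadruple `(ℂⁿ / L, H, κ, {U_i, V_j})`; the form `H` is complex linear in
its first argument and conjugate linear in its second one, and `κ` is anti-linear. -/
structure Quadruple (n : ℕ) where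
  /-- The subgroup `L` of `ℂⁿ`. -/
  L : Submodule ℤ (Fin n → ℂ)
  /-- The sesquilinear form `H`. -/
  H : (Fin n → ℂ) →ₗ[ℂ] (Fin n → ℂ) →ₗ⋆[ℂ] ℂ
  /-- The anti-linear map `κ`. -/
  κ : (Fin n → ℂ) →ₗ⋆[ℂ] (Fin n → ℂ)
  /-- The points `U_i` of `ℂⁿ / L`. -/
  U : Fin n → (Fin n → ℂ) ⧸ L
  /-- The points `V_j` of `ℂⁿ / L`. -/
  V : Fin n → (Fin n → ℂ) ⧸ L

namespace Quadruple

variable {n : ℕ}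

/-- The real symplectic form `Q = Im H`. -/
def Q (A : Quadruple n) (u v : Fin n → ℂ) : ℝ := (A.H u v).im

/-- `{u_i, v_j}` is a `ℤ`-basis of `L` in which `Q` has the matrix `(0 I; -I 0)`. -/
structure IsSymplecticBasis (A : Quadruple n) (u v : Fin n → Fin n → ℂ) : Prop where
  linearIndependent : LinearIndependent ℤ (Sum.elim u v)
  span_eq : Submodule.span ℤ (Set.range (Sum.elim u v)) = A.L
  uu : ∀ i j, A.Q (u i) (u j) = 0
  uv : ∀ i j, A.Q (u i) (v j) = if i = j then 1 else 0
  vu : ∀ i j, A.Q (v i) (u j) = if i = j then -1 else 0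
  vv : ∀ i j, A.Q (v i) (v j) = 0

/-- `(ℂⁿ / L, H)` is a principally polarized abelian variety: `L` is a lattice, `H` is a positive
definite Hermitian form, and `L` is symplectic with respect to `Q = Im H`. -/
structure IsPPAV (A : Quadruple n) : Prop where
  lattice : ∃ _ : DiscreteTopology A.L, IsZLattice ℝ A.L
  hermitian : ∀ u v, A.H v u = starRingEnd ℂ (A.H u v)
  posDef : ∀ u, u ≠ 0 → 0 < (A.H u u).re
  symplectic : ∃ u v, A.IsSymplecticBasis u v

/-- `κ` is a real structure compatible with the polarization. -/
structure IsRealStructure (A : Quadruple n) : Prop where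
  involutive : Function.Involutive A.κ
  map_lattice : A.κ '' (A.L : Set (Fin n → ℂ)) = A.L
  compatible : ∀ u v, A.Q (A.κ u) (A.κ v) = -A.Q u v

/-- `{U_i, V_j}` is a basis of the group of `N`-torsion points of `ℂⁿ / L` over `ℤ / N`. -/
structure IsTorsionBasis (N : ℕ) (A : Quadruple n) : Prop where
  torsion : ∀ k, N • Sum.elim A.U A.V k = 0
  span : ∀ a : (Fin n → ℂ) ⧸ A.L, N • a = 0 →
    ∃ c : Fin n ⊕ Fin n → ℤ, a = ∑ k, c k • Sum.elim A.U A.V k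
  independent : ∀ c : Fin n ⊕ Fin n → ℤ, ∑ k, c k • Sum.elim A.U A.V k = 0 →
    ∀ k, (N : ℤ) ∣ c k

/-- `{u_i, v_j}` is a lift of `{U_i, V_j}`: a symplectic basis of `L` such that `U_i ≡ u_i / N`
and `V_j ≡ v_j / N` modulo `L`. -/
structure IsLift (N : ℕ) (A : Quadruple n) (u v : Fin n → Fin n → ℂ) : Prop where
  basis : A.IsSymplecticBasis u v
  U_eq : ∀ i, A.U i = A.L.mkQ ((N : ℂ)⁻¹ • u i)
  V_eq : ∀ j, A.V j = A.L.mkQ ((N : ℂ)⁻¹ • v j)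

/-- `{U_i, V_j}` is a level `N` structure. -/
structure IsLevelStructure (N : ℕ) (A : Quadruple n) : Prop where
  torsionBasis : A.IsTorsionBasis N
  exists_lift : ∃ u v, A.IsLift N u v

/-- The level `N` structure is compatible with `κ`: for some lift, `κ (u_i / N) ≡ - u_i / N` and
`κ (v_j / N) ≡ v_j / N` modulo `L`. -/
def IsCompatible (N : ℕ) (A : Quadruple n) : Prop :=
  ∃ u v, A.IsLift N u v ∧
    (∀ i, A.L.mkQ (A.κ ((N : ℂ)⁻¹ • u i)) = A.L.mkQ (-((N : ℂ)⁻¹ • u i))) ∧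
    (∀ j, A.L.mkQ (A.κ ((N : ℂ)⁻¹ • v j)) = A.L.mkQ ((N : ℂ)⁻¹ • v j))

/-- The quadruple is a real principally polarized abelian variety with (compatible) level `N`
structure. -/
structure IsRealPPAVWithLevel (N : ℕ) (A : Quadruple n) : Prop where
  ppav : A.IsPPAV
  real : A.IsRealStructure
  level : A.IsLevelStructure N
  compatible : A.IsCompatible N

/-- `φ` is an isomorphism `A ≅ A'`: it carries `L` to `L'`, `H` to `H'` and `κ` to `κ'`, and
`φ (u_i / N) ≡ u'_i / N`, `φ (v_j / N) ≡ v'_j / N` modulo `L'` for some lifts of the level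
structures. -/
structure IsIso (N : ℕ) (A A' : Quadruple n) (φ : (Fin n → ℂ) ≃ₗ[ℂ] (Fin n → ℂ)) : Prop where
  map_L : φ '' (A.L : Set (Fin n → ℂ)) = A'.L
  map_H : ∀ u v, A'.H (φ u) (φ v) = A.H u v
  map_κ : ∀ u, φ (A.κ u) = A'.κ (φ u)
  map_level : ∃ u v u' v', A.IsLift N u v ∧ A'.IsLift N u' v' ∧
    (∀ i, A'.L.mkQ (φ ((N : ℂ)⁻¹ • u i)) = A'.L.mkQ ((N : ℂ)⁻¹ • u' i)) ∧
    (∀ j, A'.L.mkQ (φ ((N : ℂ)⁻¹ • v j)) = A'.L.mkQ ((N : ℂ)⁻¹ • v' j))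

theorem mkQ_map_eq {L L' : Submodule ℤ (Fin n → ℂ)} {φ : (Fin n → ℂ) ≃ₗ[ℂ] (Fin n → ℂ)}
    (h : φ '' (L : Set (Fin n → ℂ)) = L') {x y : Fin n → ℂ} :
    L'.mkQ (φ x) = L'.mkQ (φ y) ↔ L.mkQ x = L.mkQ y := by
  simp only [Submodule.mkQ_apply, Submodule.Quotient.eq]
  rw [← SetLike.mem_coe, ← h, ← map_sub, φ.injective.mem_set_image, SetLike.mem_coe]

theorem isIso_refl {N : ℕ} {A : Quadruple n} (hA : A.IsLevelStructure N) :
    IsIso N A A (LinearEquiv.refl ℂ _) := by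
  obtain ⟨u, v, h⟩ := hA.exists_lift
  exact ⟨Set.image_id _, fun _ _ => rfl, fun _ => rfl, u, v, u, v, h, h, fun _ => rfl, fun _ => rfl⟩

theorem IsIso.symm {N : ℕ} {A A' : Quadruple n} {φ : (Fin n → ℂ) ≃ₗ[ℂ] (Fin n → ℂ)}
    (h : IsIso N A A' φ) : IsIso N A' A φ.symm := by
  obtain ⟨u, v, u', v', hl, hl', hu, hv⟩ := h.map_level
  refine ⟨?_, ?_, ?_, u', v', u, v, hl', hl, ?_, ?_⟩
  · rw [← h.map_L, ← Set.image_comp]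
    have e : (φ.symm : (Fin n → ℂ) → Fin n → ℂ) ∘ φ = id := funext φ.symm_apply_apply
    rw [e, Set.image_id]
  · intro x y
    have := h.map_H (φ.symm x) (φ.symm y)
    simpa using this.symm
  · intro x
    apply φ.injective
    rw [h.map_κ, LinearEquiv.apply_symm_apply, LinearEquiv.apply_symm_apply]
  · intro i
    rw [← mkQ_map_eq h.map_L, LinearEquiv.apply_symm_apply, hu i]
  · intro i
    rw [← mkQ_map_eq h.map_L, LinearEquiv.apply_symm_apply, hv i]

theorem IsIso.trans {N : ℕ} {A A' A'' : Quadruple n} {φ ψ : (Fin n → ℂ) ≃ₗ[ℂ] (Fin n → ℂ)}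
    (h : IsIso N A A' φ) (h' : IsIso N A' A'' ψ) : IsIso N A A'' (φ.trans ψ) := by
  obtain ⟨u, v, u', v', hl, hl', hu, hv⟩ := h.map_level
  obtain ⟨p, q, p', q', kl, kl', ku, kv⟩ := h'.map_level
  refine ⟨?_, ?_, ?_, u, v, p', q', hl, kl', ?_, ?_⟩
  · rw [← h'.map_L, ← h.map_L, ← Set.image_comp]
    rfl
  · intro x y
    rw [← h.map_H, ← h'.map_H]
    rfl
  · intro x
    rw [LinearEquiv.trans_apply, h.map_κ, h'.map_κ]
    rfl
  · intro i
    rw [LinearEquiv.trans_apply, ← ku i, mkQ_map_eq h'.map_L, hu i, ← hl'.U_eq, ← kl.U_eq]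
  · intro i
    rw [LinearEquiv.trans_apply, ← kv i, mkQ_map_eq h'.map_L, hv i, ← hl'.V_eq, ← kl.V_eq]

end Quadruple

/-- The type of real principally polarized abelian varieties of dimension `n` with level `N`
structure. -/
abbrev RealPPAV (n N : ℕ) : Type := {A : Quadruple n // A.IsRealPPAVWithLevel N}

/-- Isomorphism of real principally polarized abelian varieties with level `N` structure. -/
instance isoSetoid (n N : ℕ) : Setoid (RealPPAV n N) where
  r A A' := ∃ φ, Quadruple.IsIso N A.1 A'.1 φ
  iseqv :=
    ⟨fun A => ⟨_, Quadruple.isIso_refl A.2.level⟩, fun ⟨_, h⟩ => ⟨_, h.symm⟩,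
      fun ⟨_, h⟩ ⟨_, h'⟩ => ⟨_, h.trans h'⟩⟩

/-- The set of isomorphism classes of real principally polarized abelian varieties with level `N`
structure. -/
abbrev IsoClasses (n N : ℕ) : Type := Quotient (isoSetoid n N)

/-! # The quadruple attached to a real point -/

section Standard

variable {n : ℕ}

/-- The map `F_Z : ℝⁿ ⊕ ℝⁿ → ℂⁿ`, `F_Z (x, y) = Z x + y`. -/
def FZ (Z : SiegelSpace n) (x y : Fin n → ℝ) : Fin n → ℂ :=
  Z.mat *ᵥ (fun i => (x i : ℂ)) + fun i => (y i : ℂ)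

/-- The lattice `L_Z = F_Z (ℤⁿ ⊕ ℤⁿ)`. -/
def LZ (Z : SiegelSpace n) : Submodule ℤ (Fin n → ℂ) where
  carrier := {w | ∃ x y : Fin n → ℤ, w = FZ Z (fun i => (x i : ℝ)) (fun i => (y i : ℝ))}
  zero_mem' := ⟨0, 0, by ext; simp [FZ, mulVec, dotProduct]⟩
  add_mem' := by
    rintro _ _ ⟨x, y, rfl⟩ ⟨x', y', rfl⟩
    refine ⟨x + x', y + y', ?_⟩
    ext i
    simp [FZ, mulVec, dotProduct, mul_add, Finset.sum_add_distrib]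
    ring
  smul_mem' := by
    rintro c _ ⟨x, y, rfl⟩
    refine ⟨c • x, c • y, ?_⟩
    ext i
    simp [FZ, mulVec, dotProduct, Finset.mul_sum, mul_left_comm]

/-- The Hermitian form `H_Z (u, v) = ᵗu (Im Z)⁻¹ v̄`. -/
def HZ (Z : SiegelSpace n) : (Fin n → ℂ) →ₗ[ℂ] (Fin n → ℂ) →ₗ⋆[ℂ] ℂ :=
  LinearMap.mk₂'ₛₗ (RingHom.id ℂ) (starRingEnd ℂ)
    (fun u v => u ⬝ᵥ (((Z.mat.map Complex.im)⁻¹).map Complex.ofReal *ᵥ star v))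
    (fun _ _ _ => add_dotProduct _ _ _)
    (fun _ _ _ => smul_dotProduct _ _ _)
    (fun _ _ _ => by rw [star_add, mulVec_add, dotProduct_add])
    (fun _ _ _ => by rw [star_smul, mulVec_smul, dotProduct_smul]; rfl)

/-- The anti-linear map `κ(γ, Z) : M ↦ ᵗ(C Z + D) M̄`, where `γ = (A B; C D)`. -/
def kappa (γ : Sp n ℤ) (Z : SiegelSpace n) : (Fin n → ℂ) →ₗ⋆[ℂ] (Fin n → ℂ) where
  toFun M := (denom (spMap (Int.castRingHom ℝ) γ) Z.mat)ᵀ *ᵥ star M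
  map_add' _ _ := by rw [star_add, mulVec_add]
  map_smul' _ _ := by rw [star_smul, mulVec_smul]; rfl

/-- The quadruple `(A_Z, H_Z, κ(γ, Z), {F_Z (e_i / N), F_Z (f_j / N)})`, with the standard level
`N` structure. -/
def stdQuadruple (N : ℕ) (γ : Sp n ℤ) (Z : SiegelSpace n) : Quadruple n where
  L := LZ Z
  H := HZ Z
  κ := kappa γ Z
  U i := (LZ Z).mkQ (FZ Z ((N : ℝ)⁻¹ • Pi.single i 1) 0)
  V j := (LZ Z).mkQ (FZ Z 0 ((N : ℝ)⁻¹ • Pi.single j 1))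

end Standard

end

end RealAV

open RealAV

/-! Everything is computed in period coordinates. Through `F_Z`, the lattice `L_Z` becomes the
integral vectors and `Im H_Z` becomes the standard symplectic form, so maps between the abelian
varieties become integral matrices. Two dictionary entries carry the proof. For symplectic `h`, the
complex linear map `ᵗ(CZ+D)` sends the periods of `h • Z` to those of `Z` by the matrix `ᵗh`;
conversely a complex linear map acting by `ᵗh` on periods must be this one, and its source point
must be `h • Z` (`denom_transpose_mulVec_period`, `smul_eq_of_period`). Complex conjugation sends
the periods of `Z` to those of `τZ` by `S = (-1 0; 0 1)`. Hence, when `γ • Z = τZ`, the map `κ_Z`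
has matrix `ᵗγ S`, and every anti-linear map with such a matrix arises in this way
(`eq_kappa_of_period`).

The level enters through freeness: `Γ(N)` acts freely for `N ≥ 3`, because a stabilizer element
gives an integral isometry of the positive definite form `Re H_Z` that is congruent to the identity
(`eq_one_of_isometry_of_congr`). Freeness gives the uniqueness of `γ`, the identity `τ(γ)γ = 1` that
makes `κ_Z` an involution, and the relation `γ'h = τ(h)γ` that makes `ᵗ(CZ+D)` intertwine the real
structures, so that the class of the quadruple depends only on `[Z]`.

Injectivity reads an isomorphism as an integral matrix: preserving `H` makes it symplectic and
preserving the level puts it in `Γ(N)`. For surjectivity, a compatible lift is a symplectic basis,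
the Riemann relations turn it into a point `Z`, and the matrix `M` of `κ` in this basis determines
`γ = S ᵗM`. That `κ` reverses `Q` says that `γ` is symplectic; compatibility with the level says
that `γ ∈ Γ(N)`. -/

namespace RealAV

/-! ### Rigidity of integral isometries congruent to the identity -/

/-- A positive definite continuous quadratic form on `ℝ^ι` takes values at most `C` at only
finitely many integral vectors. -/
theorem finite_integral_le {ι : Type*} [Fintype ι] {q : (ι → ℝ) → ℝ} (hq : Continuous q)
    (hsmul : ∀ (c : ℝ) a, q (c • a) = c ^ 2 * q a) (hpos : ∀ a, a ≠ 0 → 0 < q a) (C : ℝ) :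
    {w : ι → ℤ | q (fun i => (w i : ℝ)) ≤ C}.Finite := by
  -- By homogeneity `c` can be the minimum of `q` on the compact unit sphere; when the sphere is
  -- empty, every vector is zero and any `c` works.
  obtain ⟨c, hc, hle⟩ : ∃ c : ℝ, 0 < c ∧ ∀ a, c * ‖a‖ ^ 2 ≤ q a := by
    rcases (Metric.sphere (0 : ι → ℝ) 1).eq_empty_or_nonempty with he | hne
    · refine ⟨1, one_pos, fun a => ?_⟩
      have ha : a = 0 := by
        by_contra ha
        have : ‖a‖⁻¹ • a ∈ Metric.sphere (0 : ι → ℝ) 1 := by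
          simp [norm_smul, ha]
        simp [he] at this
      have := hsmul 0 0
      simp_all
    · obtain ⟨x, hx, hmin⟩ := (isCompact_sphere (0 : ι → ℝ) 1).exists_isMinOn hne hq.continuousOn
      have hx0 : x ≠ 0 := by rintro rfl; simp at hx
      refine ⟨q x, hpos x hx0, fun a => ?_⟩
      by_cases ha : a = 0
      · have := hsmul 0 0
        simp_all
      · have hm : ‖a‖⁻¹ • a ∈ Metric.sphere (0 : ι → ℝ) 1 := by
          simp [norm_smul, ha]
        have h1 : q x ≤ q (‖a‖⁻¹ • a) := hmin hm
        rw [hsmul] at h1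
        have h2 : 0 < ‖a‖ := norm_pos_iff.2 ha
        calc q x * ‖a‖ ^ 2 ≤ (‖a‖⁻¹ ^ 2 * q a) * ‖a‖ ^ 2 := by gcongr
          _ = q a := by field_simp
  refine ((isCompact_closedBall (0 : ι → ℤ) (C / c + 1)).finite_of_discrete).subset fun w hw => ?_
  rw [mem_closedBall_zero_iff]
  have e : ‖fun i => (w i : ℝ)‖ = ‖w‖ := by
    refine le_antisymm ((pi_norm_le_iff_of_nonneg (norm_nonneg _)).2 fun i => ?_)
      ((pi_norm_le_iff_of_nonneg (norm_nonneg _)).2 fun i => ?_)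
    · exact (Int.norm_eq_abs (w i)) ▸ norm_le_pi_norm w i
    · exact (Int.norm_eq_abs (w i)) ▸ norm_le_pi_norm (fun i => (w i : ℝ)) i
  have h1 := (hle (fun i => (w i : ℝ))).trans hw
  rw [e] at h1
  have h2 : ‖w‖ ^ 2 ≤ C / c := by rw [le_div_iff₀ hc]; linarith
  -- The inequality `2t ≤ t² + 1` bounds `‖w‖` without a square root; this explains the radius `C /
  -- c + 1`.
  nlinarith [sq_nonneg (‖w‖ - 1)]

/-- An integral isometry of a positive definite quadratic form that is congruent to the identity
modulo `N ≥ 3` is the identity. -/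
theorem eq_one_of_isometry_of_congr {ι : Type*} [Fintype ι] [DecidableEq ι] {q : (ι → ℝ) → ℝ}
    (hq : Continuous q) (hsmul : ∀ (c : ℝ) a, q (c • a) = c ^ 2 * q a)
    (hpar : ∀ a b, q (a + b) + q (a - b) = 2 * q a + 2 * q b) (hpos : ∀ a, a ≠ 0 → 0 < q a)
    {N : ℕ} (hN : 3 ≤ N) {M P : Matrix ι ι ℤ} (hM : M = 1 + (N : ℤ) • P)
    (hiso : ∀ w : ι → ℤ, q (fun i => ((M *ᵥ w) i : ℝ)) = q (fun i => (w i : ℝ))) : M = 1 := by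
  have hN' : (3 : ℝ) ≤ N := by exact_mod_cast hN
  set f : (ι → ℤ) → ℝ := fun w => q (fun i => (w i : ℝ)) with hf
  have fiso : ∀ w, f (M *ᵥ w) = f w := hiso
  have fpos : ∀ w, w ≠ 0 → 0 < f w := fun w hw => hpos _ fun h => hw <| by
    ext i; simpa using congrFun h i
  have fsmul : ∀ (c : ℤ) w, f (c • w) = (c : ℝ) ^ 2 * f w := fun c w => by
    rw [hf, ← hsmul]
    refine congrArg q (funext fun i => ?_)
    simp
  have fpar : ∀ a b, f (a + b) + f (a - b) = 2 * f a + 2 * f b := fun a b => by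
    have := hpar (fun i => (a i : ℝ)) (fun i => (b i : ℝ))
    rw [← this]
    refine congrArg₂ _ (congrArg q (funext fun i => ?_)) (congrArg q (funext fun i => ?_)) <;> simp
  have fnn : ∀ w, 0 ≤ f w := fun w => by
    by_cases h : w = 0
    · subst h; have := fsmul 0 0; simp at this; exact this.ge
    · exact (fpos w h).le
  have hMv : ∀ w, M *ᵥ w = w + (N : ℤ) • (P *ᵥ w) := fun w => by
    rw [hM, add_mulVec, one_mulVec, smul_mulVec]
  suffices h : ∀ w, P *ᵥ w = 0 by
    have hP : P = 0 := Matrix.ext_of_mulVec_single fun i => by rw [h, zero_mulVec]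
    rw [hM, hP, smul_zero, add_zero]
  by_contra! hcon
  obtain ⟨w₀, hw₀⟩ := hcon
  -- Descent: choose a nonzero value `v = P w` of `P` that is shortest for `f`.
  set T : Set (ι → ℤ) := {v | v ≠ 0 ∧ (∃ w, v = P *ᵥ w) ∧ f v ≤ f (P *ᵥ w₀)} with hT
  have hfin : T.Finite := (finite_integral_le hq hsmul hpos (f (P *ᵥ w₀))).subset fun v hv => hv.2.2
  obtain ⟨v, ⟨hv0, ⟨w, hw⟩, hvle⟩, hmin⟩ := T.exists_min_image f hfin ⟨_, hw₀, ⟨w₀, rfl⟩, le_rfl⟩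
  have hPv : P *ᵥ v = 0 := by
    by_contra hne
    -- The parallelogram law for `Mv` and `v` gives `N² f(Pv) ≤ 4 f(v)`, and `N ≥ 3` makes `Pv`
    -- strictly shorter than `v`.
    have h1 : f (P *ᵥ v) < f v := by
      have h2 := fpar (M *ᵥ v) v
      have h3 : M *ᵥ v - v = (N : ℤ) • (P *ᵥ v) := by rw [hMv]; abel
      rw [h3, fsmul, fiso] at h2
      have h4 := fnn (M *ᵥ v + v)
      have h5 := fpos v hv0
      have h6 := fnn (P *ᵥ v)
      push_cast at h2
      have h7 : (9 : ℝ) ≤ (N : ℝ) ^ 2 := by nlinarith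
      nlinarith [mul_le_mul_of_nonneg_right h7 h6]
    exact absurd (hmin _ ⟨hne, ⟨v, rfl⟩, h1.le.trans hvle⟩) (not_le.2 h1)
  -- Since `Pv = 0`, the iterates of `M` on `w` run along the line `w`, `w + Nv`, `w + 2Nv`. A
  -- positive definite form cannot take one value at three equally spaced distinct points: the
  -- parallelogram law forces `f(Nv) = 0`.
  have h1 : f (w + (N : ℤ) • v) = f w := by rw [← fiso w, hMv, ← hw]
  have h2 : f (w + (N : ℤ) • v + (N : ℤ) • v) = f (w + (N : ℤ) • v) := by
    rw [← fiso (w + (N : ℤ) • v), hMv (w + (N : ℤ) • v), mulVec_add, mulVec_smul, hPv, ← hw,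
      smul_zero, add_zero]
  have h3 := fpar (w + (N : ℤ) • v) ((N : ℤ) • v)
  rw [h2, add_sub_cancel_right, h1, fsmul] at h3
  have h4 := fpos v hv0
  push_cast at h3
  have : 0 < (N : ℝ) ^ 2 * f v := by positivity
  linarith

/-! ### Period coordinates and the lattice -/

variable {n : ℕ}

/-- The period map `(x, y) ↦ Z x + y` as a real linear map. -/
noncomputable def periodMap (Z : SiegelSpace n) : (Fin n ⊕ Fin n → ℝ) →ₗ[ℝ] (Fin n → ℂ) where
  toFun w := FZ Z (w ∘ Sum.inl) (w ∘ Sum.inr)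
  map_add' a b := by
    ext i
    simp [FZ, mulVec, dotProduct, mul_add, Finset.sum_add_distrib]
    ring
  map_smul' c a := by
    ext i
    simp [FZ, mulVec, dotProduct, Finset.mul_sum, mul_left_comm]

theorem periodMap_apply (Z : SiegelSpace n) (w : Fin n ⊕ Fin n → ℝ) :
    periodMap Z w = FZ Z (w ∘ Sum.inl) (w ∘ Sum.inr) := rfl

theorem FZ_im (Z : SiegelSpace n) (x y : Fin n → ℝ) :
    (fun i => (FZ Z x y i).im) = Z.mat.map Complex.im *ᵥ x := by
  ext i
  simp [FZ, mulVec, dotProduct]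

theorem FZ_re (Z : SiegelSpace n) (x y : Fin n → ℝ) :
    (fun i => (FZ Z x y i).re) = Z.mat.map Complex.re *ᵥ x + y := by
  ext i
  simp [FZ, mulVec, dotProduct]

theorem isUnit_im (Z : SiegelSpace n) : IsUnit (Z.mat.map Complex.im).det :=
  (Matrix.isUnit_iff_isUnit_det _).1 Z.im_posDef.isUnit

/-- The imaginary part of `Zx + y` is `(Im Z) x`, which determines `x` because `Im Z` is invertible;
the real part then determines `y`. -/
theorem periodMap_bijective (Z : SiegelSpace n) : Function.Bijective (periodMap Z) := by
  have hu := isUnit_im Z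
  constructor
  · rw [injective_iff_map_eq_zero]
    intro w hw
    have h1 := FZ_im Z (w ∘ Sum.inl) (w ∘ Sum.inr)
    have h2 := FZ_re Z (w ∘ Sum.inl) (w ∘ Sum.inr)
    rw [← periodMap_apply, hw] at h1 h2
    have h3 : w ∘ Sum.inl = 0 := by
      have := congrArg ((Z.mat.map Complex.im)⁻¹ *ᵥ ·) h1
      simp only [mulVec_mulVec, nonsing_inv_mul _ hu, one_mulVec] at this
      rw [← this]
      exact mulVec_zero _
    rw [h3, mulVec_zero, zero_add] at h2
    ext (i | i)
    · exact congrFun h3 i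
    · exact (congrFun h2 i).symm
  · intro v
    set x := (Z.mat.map Complex.im)⁻¹ *ᵥ fun i => (v i).im with hx
    set y := (fun i => (v i).re) - Z.mat.map Complex.re *ᵥ x with hy
    refine ⟨Sum.elim x y, ?_⟩
    have h1 := FZ_im Z x y
    have h2 := FZ_re Z x y
    rw [hx, mulVec_mulVec, mul_nonsing_inv _ hu, one_mulVec] at h1
    rw [hy, add_sub_cancel] at h2
    ext i
    exact Complex.ext (congrFun h2 i) (congrFun h1 i)

/-- The period map `(x, y) ↦ Z x + y` as a real linear isomorphism. -/
noncomputable def periodEquiv (Z : SiegelSpace n) : (Fin n ⊕ Fin n → ℝ) ≃ₗ[ℝ] (Fin n → ℂ) :=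
  LinearEquiv.ofBijective (periodMap Z) (periodMap_bijective Z)

theorem periodEquiv_apply (Z : SiegelSpace n) (w : Fin n ⊕ Fin n → ℝ) :
    periodEquiv Z w = FZ Z (w ∘ Sum.inl) (w ∘ Sum.inr) := rfl

/-- The real vector underlying an integral one. -/
def toReal {ι : Type*} (w : ι → ℤ) : ι → ℝ := fun i => (w i : ℝ)

theorem toReal_mulVec {ι : Type*} [Fintype ι] (M : Matrix ι ι ℤ) (w : ι → ℤ) :
    toReal (M *ᵥ w) = M.map (Int.castRingHom ℝ) *ᵥ toReal w := by
  ext i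
  simp [toReal, mulVec, dotProduct]

theorem mem_LZ {Z : SiegelSpace n} {v : Fin n → ℂ} :
    v ∈ LZ Z ↔ ∃ w : Fin n ⊕ Fin n → ℤ, v = periodEquiv Z (toReal w) := by
  constructor
  · rintro ⟨x, y, rfl⟩
    exact ⟨Sum.elim x y, rfl⟩
  · rintro ⟨w, rfl⟩
    exact ⟨w ∘ Sum.inl, w ∘ Sum.inr, rfl⟩

theorem periodEquiv_toReal_mem (Z : SiegelSpace n) (w : Fin n ⊕ Fin n → ℤ) :
    periodEquiv Z (toReal w) ∈ LZ Z := mem_LZ.2 ⟨w, rfl⟩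

theorem periodEquiv_mem_LZ {Z : SiegelSpace n} {w : Fin n ⊕ Fin n → ℝ} :
    periodEquiv Z w ∈ LZ Z ↔ ∃ w' : Fin n ⊕ Fin n → ℤ, w = toReal w' := by
  simp only [mem_LZ, (periodEquiv Z).injective.eq_iff]

/-- The basis of periods. -/
noncomputable def periodBasis (Z : SiegelSpace n) :
    Module.Basis (Fin n ⊕ Fin n) ℝ (Fin n → ℂ) :=
  (Pi.basisFun ℝ _).map (periodEquiv Z)

theorem periodBasis_apply (Z : SiegelSpace n) (k : Fin n ⊕ Fin n) :
    periodBasis Z k = periodEquiv Z (Pi.single k 1) := by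
  simp [periodBasis]

theorem periodEquiv_toReal (Z : SiegelSpace n) (w : Fin n ⊕ Fin n → ℤ) :
    periodEquiv Z (toReal w) = ∑ k, w k • periodBasis Z k := by
  have : toReal w = ∑ k, w k • (Pi.single k 1 : Fin n ⊕ Fin n → ℝ) := by
    ext i
    simp [toReal, Pi.single_apply, Finset.sum_apply]
  rw [this, map_sum]
  simp only [map_zsmul, periodBasis_apply]

theorem span_periodBasis (Z : SiegelSpace n) :
    Submodule.span ℤ (Set.range (periodBasis Z)) = LZ Z := by
  ext v
  rw [Submodule.mem_span_range_iff_exists_fun, mem_LZ]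
  simp only [periodEquiv_toReal, eq_comm]

theorem periodBasis_eq_elim (Z : SiegelSpace n) :
    Sum.elim (fun i => periodBasis Z (.inl i)) (fun i => periodBasis Z (.inr i)) =
      periodBasis Z := Sum.elim_comp_inl_inr _

/-! ### The polarization in period coordinates -/

theorem ofReal_dotProduct {ι : Type*} [Fintype ι] (a b : ι → ℝ) :
    (fun i => (a i : ℂ)) ⬝ᵥ (fun i => (b i : ℂ)) = ((a ⬝ᵥ b : ℝ) : ℂ) := by
  simp [dotProduct]

theorem ofReal_mulVec {ι : Type*} [Fintype ι] (Y : Matrix ι ι ℝ) (b : ι → ℝ) :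
    Y.map Complex.ofReal *ᵥ (fun i => (b i : ℂ)) = fun i => ((Y *ᵥ b) i : ℂ) := by
  ext i
  simp [mulVec, dotProduct]

theorem im_symm (Z : SiegelSpace n) : (Z.mat.map Complex.im)ᵀ = Z.mat.map Complex.im := by
  rw [← transpose_map, Z.symm]

theorem re_symm (Z : SiegelSpace n) : (Z.mat.map Complex.re)ᵀ = Z.mat.map Complex.re := by
  rw [← transpose_map, Z.symm]

theorem HZ_apply (Z : SiegelSpace n) (u v : Fin n → ℂ) :
    HZ Z u v = u ⬝ᵥ (((Z.mat.map Complex.im)⁻¹).map Complex.ofReal *ᵥ star v) := rfl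

theorem sesquilinear_im (T : Matrix (Fin n) (Fin n) ℝ) (u v : Fin n → ℂ) :
    (u ⬝ᵥ (T.map Complex.ofReal *ᵥ star v)).im =
      (fun i => (u i).im) ⬝ᵥ (T *ᵥ fun i => (v i).re) -
      (fun i => (u i).re) ⬝ᵥ (T *ᵥ fun i => (v i).im) := by
  simp only [dotProduct, mulVec, Complex.im_sum, Complex.mul_im, Complex.re_sum, Complex.mul_re,
    Matrix.map_apply, Complex.ofReal_re, Complex.ofReal_im, Pi.star_apply, Complex.star_def,
    Complex.conj_re, Complex.conj_im, ← Finset.sum_sub_distrib]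
  refine Finset.sum_congr rfl fun i _ => ?_
  simp
  ring

/-- The matrix of `Im H_Z` in the basis of periods. -/
theorem HZ_im_period (Z : SiegelSpace n) (w w' : Fin n ⊕ Fin n → ℝ) :
    (HZ Z (periodEquiv Z w) (periodEquiv Z w')).im = -(w ⬝ᵥ (J (Fin n) ℝ *ᵥ w')) := by
  have hu := isUnit_im Z
  have hs : ((Z.mat.map Complex.im)⁻¹)ᵀ = (Z.mat.map Complex.im)⁻¹ := by
    rw [transpose_nonsing_inv, im_symm]
  have hr := re_symm Z
  have hY := im_symm Z
  rw [HZ_apply, sesquilinear_im, periodEquiv_apply, periodEquiv_apply]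
  simp only [FZ_im, FZ_re]
  set x := w ∘ Sum.inl with hx
  set y := w ∘ Sum.inr with hy
  set x' := w' ∘ Sum.inl with hx'
  set y' := w' ∘ Sum.inr with hy'
  -- Here `J` is `(0 -1; 1 0)`, the negative of the matrix required of `Q` in a symplectic basis;
  -- this is the source of the minus sign.
  have e : w ⬝ᵥ (J (Fin n) ℝ *ᵥ w') = y ⬝ᵥ x' - x ⬝ᵥ y' := by
    simp only [J, fromBlocks_mulVec, dotProduct, Fintype.sum_sum_type, Sum.elim_inl, Sum.elim_inr]
    simp [hx, hy, hx', hy', neg_mulVec, ← sub_eq_neg_add]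
  rw [e]
  generalize Z.mat.map Complex.im = Y at *
  generalize Z.mat.map Complex.re = X at *
  -- After `Y` cancels against `Y⁻¹`, there remains `x·(Xx' + y') - (Xx + y)·x'`, whose terms in `X`
  -- cancel by symmetry.
  rw [mulVec_mulVec x', nonsing_inv_mul _ hu, one_mulVec, add_dotProduct,
    dotProduct_mulVec (Y *ᵥ x), ← mulVec_transpose, hs, mulVec_mulVec, nonsing_inv_mul _ hu,
    one_mulVec, dotProduct_add, dotProduct_mulVec x X x', ← mulVec_transpose, hr]
  ring

theorem HZ_hermitian (Z : SiegelSpace n) (u v : Fin n → ℂ) :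
    HZ Z v u = starRingEnd ℂ (HZ Z u v) := by
  have hs : ((Z.mat.map Complex.im)⁻¹)ᵀ = (Z.mat.map Complex.im)⁻¹ := by
    rw [transpose_nonsing_inv, im_symm]
  have hs' : ∀ i j, (Z.mat.map Complex.im)⁻¹ j i = (Z.mat.map Complex.im)⁻¹ i j :=
    fun i j => congrFun (congrFun hs i) j
  simp only [HZ_apply, dotProduct, mulVec, map_sum, map_mul, Finset.mul_sum, Matrix.map_apply]
  rw [Finset.sum_comm]
  refine Finset.sum_congr rfl fun i _ => Finset.sum_congr rfl fun j _ => ?_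
  simp [hs' i j]
  ring

theorem HZ_posDef (Z : SiegelSpace n) (u : Fin n → ℂ) (hu : u ≠ 0) : 0 < (HZ Z u u).re := by
  open scoped ComplexOrder in
  have h := (posDef_ofReal_iff.2 Z.im_posDef.inv).dotProduct_mulVec_pos (x := star u)
    (star_ne_zero.2 hu)
  rw [star_star] at h
  exact (Complex.pos_iff.1 h).1

/-- A form that is complex linear in its first argument is determined by its imaginary part. -/
theorem form_eq_of_im_eq {H H' : (Fin n → ℂ) →ₗ[ℂ] (Fin n → ℂ) →ₗ⋆[ℂ] ℂ}
    {φ : (Fin n → ℂ) →ₗ[ℂ] (Fin n → ℂ)}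
    (h : ∀ u v, (H' (φ u) (φ v)).im = (H u v).im) (u v : Fin n → ℂ) :
    H' (φ u) (φ v) = H u v := by
  refine Complex.ext ?_ (h u v)
  -- Linearity in the first argument gives `Im H(iu, v) = Re H(u, v)`.
  have := h (Complex.I • u) v
  simpa using this

/-! ### Symplectic matrices acting on periods -/

/-- The real symplectic matrix underlying an integral one. -/
abbrev spReal (g : Sp n ℤ) : Sp n ℝ := spMap (Int.castRingHom ℝ) g

/-- Transpose `(h • Z)(CZ+D) = AZ+B` and use that `h • Z` is symmetric. This is why the transpose of
`CZ+D` is the map that compares periods. -/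
theorem denom_transpose_mul_smul (h : Sp n ℝ) (Z : SiegelSpace n) :
    (denom h Z.mat)ᵀ * (h • Z).mat = (num h Z.mat)ᵀ := by
  rw [← (h • Z).symm, ← transpose_mul, smul_mat,
    nonsing_inv_mul_cancel_right _ _ ((Matrix.isUnit_iff_isUnit_det _).1 (isUnit_denom h Z))]

/-- The period map at `hᵀ w`. -/
theorem periodEquiv_transpose_mulVec (h : Sp n ℝ) (Z : SiegelSpace n) (w : Fin n ⊕ Fin n → ℝ) :
    periodEquiv Z (h.1ᵀ *ᵥ w) = (num h Z.mat)ᵀ *ᵥ (fun i => (w (.inl i) : ℂ)) +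
      (denom h Z.mat)ᵀ *ᵥ fun i => (w (.inr i) : ℂ) := by
  have e : ∀ (M : Matrix (Fin n) (Fin n) ℝ) (v : Fin n → ℝ),
      (fun i => (((Mᵀ *ᵥ v) i : ℝ) : ℂ)) = (M.map Complex.ofReal)ᵀ *ᵥ fun i => (v i : ℂ) := by
    intro M v
    rw [← transpose_map, ofReal_mulVec]
  have hl : (h.1ᵀ *ᵥ w) ∘ Sum.inl = (blockA h)ᵀ *ᵥ (w ∘ Sum.inl) +
      (blockC h)ᵀ *ᵥ (w ∘ Sum.inr) := by
    ext i
    simp [mulVec, dotProduct, toBlocks₁₁, toBlocks₂₁]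
  have hr : (h.1ᵀ *ᵥ w) ∘ Sum.inr = (blockB h)ᵀ *ᵥ (w ∘ Sum.inl) +
      (blockD h)ᵀ *ᵥ (w ∘ Sum.inr) := by
    ext i
    simp [mulVec, dotProduct, toBlocks₁₂, toBlocks₂₂]
  have hadd : ∀ a b : Fin n → ℝ, (fun i => (((a + b) i : ℝ) : ℂ)) =
      (fun i => (a i : ℂ)) + fun i => (b i : ℂ) := fun a b => by
    ext i
    simp
  have hA : (blockA h).map Complex.ofReal = blockA (toC h) := rfl
  have hB : (blockB h).map Complex.ofReal = blockB (toC h) := rfl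
  have hC : (blockC h).map Complex.ofReal = blockC (toC h) := rfl
  have hD : (blockD h).map Complex.ofReal = blockD (toC h) := rfl
  rw [periodEquiv_apply, FZ, hl, hr, hadd, hadd, e, e, e, e, hA, hB, hC, hD, num, denom,
    transpose_add, transpose_add, transpose_mul, transpose_mul, Z.symm]
  simp only [Function.comp_apply, mulVec_add, add_mulVec, mulVec_mulVec]
  abel

/-- `ᵗ(C Z + D)` carries the periods of `h • Z` to those of `Z`, acting on them by `ᵗh`. -/
theorem denom_transpose_mulVec_period (h : Sp n ℝ) (Z : SiegelSpace n)
    (w : Fin n ⊕ Fin n → ℝ) :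
    (denom h Z.mat)ᵀ *ᵥ periodEquiv (h • Z) w = periodEquiv Z (h.1ᵀ *ᵥ w) := by
  rw [periodEquiv_transpose_mulVec, periodEquiv_apply, FZ, mulVec_add, mulVec_mulVec,
    denom_transpose_mul_smul]
  rfl

/-- A complex linear map that carries the periods of `Z'` to those of `Z` through `ᵗh` is
`ᵗ(C Z + D)`, and then `Z' = h • Z`. -/
theorem smul_eq_of_period {h : Sp n ℝ} {Z Z' : SiegelSpace n} {φ : (Fin n → ℂ) →ₗ[ℂ] (Fin n → ℂ)}
    (hφ : ∀ w, φ (periodEquiv Z' w) = periodEquiv Z (h.1ᵀ *ᵥ w)) :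
    h • Z = Z' ∧ ∀ v, φ v = (denom h Z.mat)ᵀ *ᵥ v := by
  -- The periods at the `f_i` are the standard complex basis, whatever the point, so they determine
  -- `φ`.
  have h1 : φ = (denom h Z.mat)ᵀ.mulVecLin := by
    refine LinearMap.pi_ext' fun i => LinearMap.ext_ring ?_
    have h2 := hφ (Pi.single (.inr i) 1)
    rw [periodEquiv_transpose_mulVec] at h2
    have h3 : periodEquiv Z' (Pi.single (.inr i) 1) = Pi.single i 1 := by
      ext j
      simp [periodEquiv_apply, FZ, mulVec, dotProduct, Pi.single_apply, apply_ite Complex.ofReal]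
    have h4 : (fun j => ((Pi.single (.inr i) 1 : Fin n ⊕ Fin n → ℝ) (.inl j) : ℂ)) = 0 := by
      ext j
      simp
    have h5 : (fun j => ((Pi.single (.inr i) 1 : Fin n ⊕ Fin n → ℝ) (.inr j) : ℂ))
        = Pi.single i 1 := by
      ext j
      simp [Pi.single_apply, apply_ite Complex.ofReal]
    rw [h3, h4, h5, mulVec_zero, zero_add] at h2
    exact h2
  refine ⟨SiegelSpace.ext ?_, fun v => by rw [h1]; rfl⟩
  -- The periods at the `e_i` are the columns of `Z'`; comparing them with those of `h • Z`
  -- identifies the two points.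
  have h2 : (denom h Z.mat)ᵀ * Z'.mat = (num h Z.mat)ᵀ := by
    refine Matrix.ext_of_mulVec_single fun i => ?_
    have h2 := hφ (Pi.single (.inl i) 1)
    rw [periodEquiv_transpose_mulVec, periodEquiv_apply, FZ, h1, mulVecLin_apply] at h2
    have h4 : (fun j => ((Pi.single (.inl i) 1 : Fin n ⊕ Fin n → ℝ) (.inr j) : ℂ)) = 0 := by
      ext j
      simp
    have h5 : (fun j => ((Pi.single (.inl i) 1 : Fin n ⊕ Fin n → ℝ) (.inl j) : ℂ))
        = Pi.single i 1 := by
      ext j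
      simp [Pi.single_apply, apply_ite Complex.ofReal]
    simp only [Function.comp_apply, h4, h5, mulVec_zero, add_zero] at h2
    rw [← mulVec_mulVec]
    exact h2
  have hu : IsUnit ((denom h Z.mat)ᵀ).det := by
    rw [det_transpose]
    exact (Matrix.isUnit_iff_isUnit_det _).1 (isUnit_denom h Z)
  rw [← nonsing_inv_mul_cancel_left _ (h • Z).mat hu, denom_transpose_mul_smul, ← h2,
    nonsing_inv_mul_cancel_left _ _ hu]

/-! ### Conjugation and the anti-linear maps κ -/

/-- The matrix `(-1 0; 0 1)`. -/
def signMat (n : ℕ) (R : Type) [CommRing R] : Matrix (Fin n ⊕ Fin n) (Fin n ⊕ Fin n) R :=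
  fromBlocks (-1) 0 0 1

section SignMat

variable {R : Type} [CommRing R]

theorem signMat_mul_self : signMat n R * signMat n R = 1 := by
  simp [signMat, fromBlocks_multiply]

theorem signMat_transpose : (signMat n R)ᵀ = signMat n R := by
  simp [signMat, fromBlocks_transpose]

theorem signMat_mul_J_mul : signMat n R * J (Fin n) R * signMat n R = -J (Fin n) R := by
  simp [signMat, J, fromBlocks_multiply, fromBlocks_neg]

theorem signMat_map {S : Type} [CommRing S] (f : R →+* S) :
    (signMat n R).map f = signMat n S := by
  simp [signMat, fromBlocks_map, Matrix.map_neg]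

theorem spTau_val (g : Sp n R) : (spTau g).1 = signMat n R * g.1 * signMat n R := by
  rw [← fromBlocks_toBlocks g.1, signMat, fromBlocks_multiply, fromBlocks_multiply]
  simp [spTau]

end SignMat

theorem tau_tau (Z : SiegelSpace n) : tau (tau Z) = Z := by
  apply SiegelSpace.ext
  ext i j
  simp [tau]

/-- The conjugate of `Zx + y` is `(-Z̄)(-x) + y`. -/
theorem star_period (Z : SiegelSpace n) (w : Fin n ⊕ Fin n → ℝ) :
    star (periodEquiv Z w) = periodEquiv (tau Z) (signMat n ℝ *ᵥ w) := by
  ext i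
  simp [periodEquiv_apply, FZ, mulVec, dotProduct, tau, signMat, fromBlocks_mulVec, one_apply]

theorem kappa_apply (γ : Sp n ℤ) (Z : SiegelSpace n) (v : Fin n → ℂ) :
    kappa γ Z v = (denom (spReal γ) Z.mat)ᵀ *ᵥ star v := rfl

theorem kappa_period {γ : Sp n ℤ} {Z : SiegelSpace n} (h : γ • Z = tau Z)
    (w : Fin n ⊕ Fin n → ℝ) :
    kappa γ Z (periodEquiv Z w) = periodEquiv Z ((spReal γ).1ᵀ *ᵥ (signMat n ℝ *ᵥ w)) := by
  rw [kappa_apply, star_period, ← h, int_smul_def, denom_transpose_mulVec_period]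

/-- An anti-linear map acting on the periods of `Z` by `ᵗγ (-1 0; 0 1)` is `κ(γ, Z)`, and then
`γ • Z = τ Z`. -/
theorem eq_kappa_of_period {γ : Sp n ℤ} {Z : SiegelSpace n}
    {κ : (Fin n → ℂ) →ₗ⋆[ℂ] (Fin n → ℂ)}
    (hκ : ∀ w, κ (periodEquiv Z w) = periodEquiv Z ((spReal γ).1ᵀ *ᵥ (signMat n ℝ *ᵥ w))) :
    γ • Z = tau Z ∧ κ = kappa γ Z := by
  -- Precomposing `κ` with conjugation gives a complex linear map that sends the periods of `τZ` to
  -- those of `Z` by `ᵗγ`.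
  let φ : (Fin n → ℂ) →ₗ[ℂ] (Fin n → ℂ) :=
    { toFun := fun v => κ (star v)
      map_add' := fun a b => by rw [star_add, map_add]
      map_smul' := fun c a => by simp }
  obtain ⟨h1, h2⟩ := smul_eq_of_period (h := spReal γ) (Z := Z) (Z' := tau Z) (φ := φ) fun w => by
    change κ (star _) = _
    rw [star_period, tau_tau, hκ, mulVec_mulVec _ (signMat n ℝ) (signMat n ℝ), signMat_mul_self,
      one_mulVec]
  refine ⟨h1, LinearMap.ext fun v => ?_⟩
  have := h2 (star v)
  change κ (star (star v)) = _ at this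
  rwa [star_star] at this

/-! ### The congruence subgroup acts freely -/

/-- Membership in the principal congruence subgroup. -/
theorem mem_Gam_iff {N : ℕ} {g : Sp n ℤ} :
    g ∈ Gam n N ↔ ∃ P : Matrix (Fin n ⊕ Fin n) (Fin n ⊕ Fin n) ℤ, g.1ᵀ = 1 + (N : ℤ) • P := by
  have key : g ∈ Gam n N ↔ ∀ i j, (N : ℤ) ∣ g.1 i j - (1 : Matrix _ _ ℤ) i j := by
    rw [Gam, MonoidHom.mem_ker, ← Subtype.coe_inj, ← Matrix.ext_iff]
    refine forall₂_congr fun i j => ?_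
    rw [← (ZMod.intCast_zmod_eq_zero_iff_dvd _ N).eq, Int.cast_sub, sub_eq_zero]
    have : ((1 : Sp n (ZMod N)).1 i j) = (((1 : Matrix _ _ ℤ) i j : ℤ) : ZMod N) := by
      change (1 : Matrix (Fin n ⊕ Fin n) (Fin n ⊕ Fin n) (ZMod N)) i j = _
      rw [one_apply, one_apply]
      split_ifs <;> simp
    rw [this]
    rfl
  rw [key]
  constructor
  · intro h
    choose P hP using h
    refine ⟨Matrix.of fun i j => P j i, ?_⟩
    ext i j
    have := hP j i
    simp only [transpose_apply, Matrix.add_apply, Matrix.smul_apply, of_apply, smul_eq_mul, ← this,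
      one_apply, eq_comm (a := i)]
    ring
  · rintro ⟨P, hP⟩ i j
    refine ⟨P j i, ?_⟩
    have := congrFun (congrFun hP j) i
    simp only [transpose_apply, Matrix.add_apply, Matrix.smul_apply, smul_eq_mul] at this
    rw [this, one_apply, one_apply]
    simp only [eq_comm (a := i)]
    ring

/-- `Γ(N)` acts freely on `𝔥ₙ` when `N ≥ 3`. -/
theorem eq_one_of_smul_eq {N : ℕ} (hN : 3 ≤ N) {h : Sp n ℤ} (hh : h ∈ Gam n N)
    {Z : SiegelSpace n} (hZ : h • Z = Z) : h = 1 := by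
  obtain ⟨P, hP⟩ := mem_Gam_iff.1 hh
  -- Since `h • Z = Z`, the map `ᵗ(CZ+D)` acts on the periods of the single point `Z`. It preserves
  -- `Im H_Z` because `h` is symplectic, hence `H_Z` because it is complex linear; so `ᵗh` is an
  -- isometry of `Re H_Z`.
  have hmul : ∀ w, (denom (spReal h) Z.mat)ᵀ *ᵥ periodEquiv Z w =
      periodEquiv Z ((spReal h).1ᵀ *ᵥ w) := fun w => by
    have h1 := denom_transpose_mulVec_period (spReal h) Z w
    rwa [← int_smul_def, hZ] at h1
  have hHim : ∀ w w', (HZ Z (periodEquiv Z ((spReal h).1ᵀ *ᵥ w))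
      (periodEquiv Z ((spReal h).1ᵀ *ᵥ w'))).im = (HZ Z (periodEquiv Z w) (periodEquiv Z w')).im := by
    intro w w'
    have hJ : (spReal h).1 * J (Fin n) ℝ * (spReal h).1ᵀ = J (Fin n) ℝ :=
      SymplecticGroup.mem_iff.1 (spReal h).2
    rw [HZ_im_period, HZ_im_period, ← hJ, dotProduct_mulVec, dotProduct_mulVec,
      ← vecMul_transpose]
    simp only [hJ, vecMul_vecMul, dotProduct_mulVec, transpose_transpose]
  have hH : ∀ u v, HZ Z ((denom (spReal h) Z.mat)ᵀ.mulVecLin u)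
      ((denom (spReal h) Z.mat)ᵀ.mulVecLin v) = HZ Z u v := by
    refine form_eq_of_im_eq fun u v => ?_
    obtain ⟨w, rfl⟩ := (periodEquiv Z).surjective u
    obtain ⟨w', rfl⟩ := (periodEquiv Z).surjective v
    rw [mulVecLin_apply, mulVecLin_apply, hmul, hmul, hHim]
  have h1 : h.1ᵀ = 1 := by
    refine eq_one_of_isometry_of_congr (q := fun w => (HZ Z (periodEquiv Z w) (periodEquiv Z w)).re)
      ?_ ?_ ?_ ?_ hN hP ?_
    · have : Continuous (periodEquiv Z) :=
        (periodEquiv Z).toLinearMap.continuous_of_finiteDimensional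
      simp only [HZ_apply]
      fun_prop
    · intro c a
      have : ∀ v, ((c • v : Fin n → ℂ)) = (c : ℂ) • v := fun v => rfl
      simp only [map_smul, this, LinearMap.map_smulₛₗ, LinearMap.smul_apply]
      simp
      ring
    · intro a b
      simp
      ring
    · exact fun a ha => HZ_posDef Z _ (by simpa using ha)
    · intro w
      have := hH (periodEquiv Z (toReal w)) (periodEquiv Z (toReal w))
      rw [mulVecLin_apply, hmul] at this
      change (HZ Z (periodEquiv Z (toReal (h.1ᵀ *ᵥ w))) (periodEquiv Z (toReal (h.1ᵀ *ᵥ w)))).re = _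
      rw [toReal_mulVec]
      exact congrArg Complex.re this
  apply Subtype.ext
  have := congrArg transpose h1
  rwa [transpose_transpose, transpose_one] at this

/-- The product fixes `Z`, because `τ(γ) • τZ = τ(γ • Z) = ττZ = Z`, and the action is free. This is
the source of the involutivity of `κ_Z`. -/
theorem spTau_mul_self {N : ℕ} (hN : 3 ≤ N) {γ : Sp n ℤ} (hγ : γ ∈ Gam n N)
    {Z : SiegelSpace n} (h : γ • Z = tau Z) : spTau γ * γ = 1 := by
  refine eq_one_of_smul_eq hN ((Gam n N).mul_mem (spTau_mem_Gam hγ) hγ) (Z := Z) ?_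
  rw [mul_smul, h, ← tau_smul, h, tau_tau]

theorem mem_XR_iff {N : ℕ} {Z : SiegelSpace n} :
    toX N Z ∈ XR n N ↔ ∃ γ : Sp n ℤ, γ ∈ Gam n N ∧ γ • Z = tau Z := by
  change Quotient.mk _ (tau Z) = Quotient.mk _ Z ↔ _
  rw [Quotient.eq]
  constructor
  · rintro ⟨g, hg⟩
    exact ⟨g.1, g.2, hg⟩
  · rintro ⟨γ, h1, h2⟩
    exact ⟨⟨γ, h1⟩, h2⟩

theorem eq_of_smul_eq {N : ℕ} (hN : 3 ≤ N) {g h : Sp n ℤ} (hg : g ∈ Gam n N) (hh : h ∈ Gam n N)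
    {Z : SiegelSpace n} (e : g • Z = h • Z) : g = h := by
  have := eq_one_of_smul_eq hN ((Gam n N).mul_mem ((Gam n N).inv_mem hh) hg) (Z := Z)
    (by rw [mul_smul, e, inv_smul_smul])
  exact (inv_mul_eq_one.1 this).symm

/-! ### Integral matrices and their action on torsion -/

theorem mulVec_dotProduct_mulVec_mulVec {ι R : Type*} [Fintype ι] [CommRing R] (K M : Matrix ι ι R)
    (w w' : ι → R) : (M *ᵥ w) ⬝ᵥ (K *ᵥ (M *ᵥ w')) = w ⬝ᵥ ((Mᵀ * K * M) *ᵥ w') := by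
  rw [mulVec_mulVec, dotProduct_mulVec, ← vecMul_transpose, vecMul_vecMul, ← dotProduct_mulVec,
    Matrix.mul_assoc]

theorem HZ_im_period_mulVec (Z : SiegelSpace n) (M : Matrix (Fin n ⊕ Fin n) (Fin n ⊕ Fin n) ℝ)
    (w w' : Fin n ⊕ Fin n → ℝ) :
    (HZ Z (periodEquiv Z (M *ᵥ w)) (periodEquiv Z (M *ᵥ w'))).im =
      -(w ⬝ᵥ ((Mᵀ * J (Fin n) ℝ * M) *ᵥ w')) := by
  rw [HZ_im_period, mulVec_dotProduct_mulVec_mulVec]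

theorem inv_smul_period (N : ℕ) (Z : SiegelSpace n) (w : Fin n ⊕ Fin n → ℝ) :
    (N : ℂ)⁻¹ • periodEquiv Z w = periodEquiv Z ((N : ℝ)⁻¹ • w) := by
  rw [map_smul]
  ext i
  simp

theorem toReal_single (k : Fin n ⊕ Fin n) : toReal (Pi.single k 1) = Pi.single k 1 := by
  ext i
  simp [toReal, Pi.single_apply]

theorem mkQ_inv_smul_eq_iff {N : ℕ} (hN : N ≠ 0) (Z : SiegelSpace n) (a b : Fin n ⊕ Fin n → ℤ) :
    (LZ Z).mkQ ((N : ℂ)⁻¹ • periodEquiv Z (toReal a)) =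
      (LZ Z).mkQ ((N : ℂ)⁻¹ • periodEquiv Z (toReal b)) ↔ ∃ c, a = b + (N : ℤ) • c := by
  have hN' : (N : ℝ) ≠ 0 := Nat.cast_ne_zero.2 hN
  rw [Submodule.mkQ_apply, Submodule.mkQ_apply, Submodule.Quotient.eq, inv_smul_period,
    inv_smul_period, ← map_sub, periodEquiv_mem_LZ]
  refine exists_congr fun c => ?_
  simp only [funext_iff]
  refine forall_congr' fun i => ?_
  simp only [toReal, Pi.sub_apply, Pi.smul_apply, smul_eq_mul, Pi.add_apply, ← mul_sub]
  rw [inv_mul_eq_iff_eq_mul₀ hN', sub_eq_iff_eq_add']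
  exact_mod_cast Iff.rfl

/-- Two integral matrices induce the same map on `N`-torsion if and only if they are congruent. -/
theorem congr_iff_mkQ_eq {N : ℕ} (hN : N ≠ 0) (Z : SiegelSpace n)
    (M M' : Matrix (Fin n ⊕ Fin n) (Fin n ⊕ Fin n) ℤ) :
    (∀ k, (LZ Z).mkQ ((N : ℂ)⁻¹ • periodEquiv Z (toReal (M *ᵥ Pi.single k 1))) =
      (LZ Z).mkQ ((N : ℂ)⁻¹ • periodEquiv Z (toReal (M' *ᵥ Pi.single k 1)))) ↔
    ∃ P, M = M' + (N : ℤ) • P := by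
  simp only [mkQ_inv_smul_eq_iff hN]
  constructor
  · intro h
    choose c hc using h
    refine ⟨Matrix.of fun i k => c k i, Matrix.ext_of_mulVec_single fun k => ?_⟩
    rw [hc k, add_mulVec, smul_mulVec]
    congr 2
    ext i
    simp
  · rintro ⟨P, rfl⟩ k
    exact ⟨P *ᵥ Pi.single k 1, by rw [add_mulVec, smul_mulVec]⟩

theorem periodEquiv_map_mulVec_single (Z : SiegelSpace n)
    (M : Matrix (Fin n ⊕ Fin n) (Fin n ⊕ Fin n) ℤ) (k : Fin n ⊕ Fin n) :
    periodEquiv Z (M.map (Int.castRingHom ℝ) *ᵥ Pi.single k 1) =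
      periodEquiv Z (toReal (M *ᵥ Pi.single k 1)) := by
  rw [toReal_mulVec, toReal_single]

/-- A real linear map between lattices is given by an integral matrix in the bases of periods. -/
theorem exists_int_matrix {Z Z' : SiegelSpace n} {f : (Fin n → ℂ) →ₗ[ℝ] (Fin n → ℂ)}
    (hf : ∀ k, f (periodBasis Z k) ∈ LZ Z') :
    ∃ M : Matrix (Fin n ⊕ Fin n) (Fin n ⊕ Fin n) ℤ, ∀ w,
      f (periodEquiv Z w) = periodEquiv Z' (M.map (Int.castRingHom ℝ) *ᵥ w) := by
  choose m hm using fun k => mem_LZ.1 (hf k)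
  refine ⟨Matrix.of fun i k => m k i, fun w => ?_⟩
  suffices h : f ∘ₗ (periodEquiv Z).toLinearMap = (periodEquiv Z').toLinearMap ∘ₗ
      ((Matrix.of fun i k => m k i).map (Int.castRingHom ℝ)).mulVecLin from
    LinearMap.congr_fun h w
  refine LinearMap.pi_ext' fun k => LinearMap.ext_ring ?_
  change f (periodEquiv Z (Pi.single k 1)) = periodEquiv Z' (_ *ᵥ Pi.single k 1)
  rw [← periodBasis_apply, hm]
  congr 1
  ext i
  simp [toReal]

/-! ### The standard quadruple is a real abelian variety with level structure -/

theorem stdQuadruple_U (N : ℕ) (γ : Sp n ℤ) (Z : SiegelSpace n) (i : Fin n) :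
    (stdQuadruple N γ Z).U i = (LZ Z).mkQ ((N : ℂ)⁻¹ • periodBasis Z (.inl i)) := by
  rw [periodBasis_apply, inv_smul_period, periodEquiv_apply]
  change (LZ Z).mkQ (FZ Z _ _) = _
  congr 2 <;> ext j <;> simp [Pi.single_apply]

theorem stdQuadruple_V (N : ℕ) (γ : Sp n ℤ) (Z : SiegelSpace n) (i : Fin n) :
    (stdQuadruple N γ Z).V i = (LZ Z).mkQ ((N : ℂ)⁻¹ • periodBasis Z (.inr i)) := by
  rw [periodBasis_apply, inv_smul_period, periodEquiv_apply]
  change (LZ Z).mkQ (FZ Z _ _) = _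
  congr 2 <;> ext j <;> simp [Pi.single_apply]

theorem stdQuadruple_elim (N : ℕ) (γ : Sp n ℤ) (Z : SiegelSpace n) (k : Fin n ⊕ Fin n) :
    Sum.elim (stdQuadruple N γ Z).U (stdQuadruple N γ Z).V k =
      (LZ Z).mkQ ((N : ℂ)⁻¹ • periodBasis Z k) := by
  rcases k with i | i
  · exact stdQuadruple_U N γ Z i
  · exact stdQuadruple_V N γ Z i

theorem HZ_im_periodBasis (Z : SiegelSpace n) (k l : Fin n ⊕ Fin n) :
    (HZ Z (periodBasis Z k) (periodBasis Z l)).im = -J (Fin n) ℝ k l := by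
  rw [periodBasis_apply, periodBasis_apply, HZ_im_period]
  simp

theorem stdQuadruple_isSymplecticBasis (N : ℕ) (γ : Sp n ℤ) (Z : SiegelSpace n) :
    (stdQuadruple N γ Z).IsSymplecticBasis (fun i => periodBasis Z (.inl i))
      (fun i => periodBasis Z (.inr i)) where
  linearIndependent := by
    rw [periodBasis_eq_elim]
    exact (periodBasis Z).linearIndependent.restrict_scalars' ℤ
  span_eq := by
    rw [periodBasis_eq_elim]
    exact span_periodBasis Z
  uu i j := by
    change (HZ Z _ _).im = _
    simp [HZ_im_periodBasis, J]
  uv i j := by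
    change (HZ Z _ _).im = _
    simp [HZ_im_periodBasis, J, one_apply]
  vu i j := by
    change (HZ Z _ _).im = _
    rw [HZ_im_periodBasis]
    simp only [J, fromBlocks_apply₂₁, one_apply]
    split_ifs <;> simp
  vv i j := by
    change (HZ Z _ _).im = _
    simp [HZ_im_periodBasis, J]

theorem stdQuadruple_isLift (N : ℕ) (γ : Sp n ℤ) (Z : SiegelSpace n) :
    (stdQuadruple N γ Z).IsLift N (fun i => periodBasis Z (.inl i))
      (fun i => periodBasis Z (.inr i)) where
  basis := stdQuadruple_isSymplecticBasis N γ Z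
  U_eq := stdQuadruple_U N γ Z
  V_eq := stdQuadruple_V N γ Z

theorem stdQuadruple_isPPAV (N : ℕ) (γ : Sp n ℤ) (Z : SiegelSpace n) :
    (stdQuadruple N γ Z).IsPPAV where
  lattice := by
    change ∃ _ : DiscreteTopology (LZ Z), IsZLattice ℝ (LZ Z)
    rw [← span_periodBasis]
    exact ⟨inferInstance, inferInstance⟩
  hermitian := HZ_hermitian Z
  posDef := HZ_posDef Z
  symplectic := ⟨_, _, stdQuadruple_isSymplecticBasis N γ Z⟩

theorem sum_zsmul_mkQ_inv_smul (N : ℕ) (Z : SiegelSpace n) (c : Fin n ⊕ Fin n → ℤ) :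
    ∑ k, c k • (LZ Z).mkQ ((N : ℂ)⁻¹ • periodBasis Z k) =
      (LZ Z).mkQ ((N : ℂ)⁻¹ • periodEquiv Z (toReal c)) := by
  simp only [periodEquiv_toReal, Finset.smul_sum, map_sum, ← map_zsmul]
  refine Finset.sum_congr rfl fun k _ => ?_
  rw [smul_comm]

theorem stdQuadruple_isTorsionBasis {N : ℕ} (hN : N ≠ 0) (γ : Sp n ℤ) (Z : SiegelSpace n) :
    (stdQuadruple N γ Z).IsTorsionBasis N where
  torsion k := by
    rw [stdQuadruple_elim]
    change N • (LZ Z).mkQ _ = 0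
    rw [← map_nsmul, ← Nat.cast_smul_eq_nsmul ℂ, smul_inv_smul₀ (Nat.cast_ne_zero.2 hN),
      Submodule.mkQ_apply, Submodule.Quotient.mk_eq_zero, ← span_periodBasis]
    exact Submodule.subset_span ⟨k, rfl⟩
  span a ha := by
    obtain ⟨v, rfl⟩ := (LZ Z).mkQ_surjective a
    replace ha : N • (LZ Z).mkQ v = 0 := ha
    rw [← map_nsmul, Submodule.mkQ_apply, Submodule.Quotient.mk_eq_zero, mem_LZ] at ha
    obtain ⟨c, hc⟩ := ha
    refine ⟨c, ?_⟩
    simp only [stdQuadruple_elim]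
    refine Eq.trans ?_ (sum_zsmul_mkQ_inv_smul N Z c).symm
    rw [← hc, ← Nat.cast_smul_eq_nsmul ℂ, inv_smul_smul₀ (Nat.cast_ne_zero.2 hN)]
  independent c hc k := by
    simp only [stdQuadruple_elim] at hc
    have h1 := (sum_zsmul_mkQ_inv_smul N Z c).symm.trans hc
    have h2 : (LZ Z).mkQ ((N : ℂ)⁻¹ • periodEquiv Z (toReal 0)) = 0 := by
      have : toReal (0 : Fin n ⊕ Fin n → ℤ) = 0 := by
        ext
        simp [toReal]
      rw [this]
      simp
    obtain ⟨d, hd⟩ := (mkQ_inv_smul_eq_iff hN Z c 0).1 (h1.trans h2.symm)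
    exact ⟨d k, by simp [hd]⟩

/-- The matrix of `κ(γ, Z)` in the basis of periods. -/
abbrev kappaMat (γ : Sp n ℤ) : Matrix (Fin n ⊕ Fin n) (Fin n ⊕ Fin n) ℤ := γ.1ᵀ * signMat n ℤ

theorem kappa_period_eq_kappaMat {γ : Sp n ℤ} {Z : SiegelSpace n} (h : γ • Z = tau Z)
    (w : Fin n ⊕ Fin n → ℝ) :
    kappa γ Z (periodEquiv Z w) =
      periodEquiv Z ((kappaMat γ).map (Int.castRingHom ℝ) *ᵥ w) := by
  rw [kappa_period h, mulVec_mulVec, Matrix.map_mul, signMat_map]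
  rfl

/-- The transpose of `τ(γ)γ = SγSγ` is `(ᵗγ S)²`. -/
theorem kappaMat_mul_self {N : ℕ} (hN : 3 ≤ N) {γ : Sp n ℤ} (hγ : γ ∈ Gam n N)
    {Z : SiegelSpace n} (h : γ • Z = tau Z) : kappaMat γ * kappaMat γ = 1 := by
  have h1 := congrArg (fun g : Sp n ℤ => g.1ᵀ) (spTau_mul_self hN hγ h)
  simp only [Submonoid.coe_mul, spTau_val, transpose_mul, signMat_transpose, Submonoid.coe_one,
    transpose_one] at h1
  simpa only [kappaMat, Matrix.mul_assoc] using h1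

/-- The product is `S (γ J ᵗγ) S = S J S`, and `S` reverses `J`; on periods this says that `κ_Z`
reverses `Q`. -/
theorem kappaMat_J {R : Type} [CommRing R] (γ : Sp n R) :
    (γ.1ᵀ * signMat n R)ᵀ * J (Fin n) R * (γ.1ᵀ * signMat n R) = -J (Fin n) R := by
  rw [transpose_mul, signMat_transpose, transpose_transpose, ← signMat_mul_J_mul]
  nth_rw 2 [← SymplecticGroup.mem_iff.1 γ.2]
  simp only [Matrix.mul_assoc]

theorem signMat_mulVec_inl {R : Type} [CommRing R] (i : Fin n) :
    signMat n R *ᵥ Pi.single (.inl i) 1 = -Pi.single (.inl i) 1 := by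
  ext (j | j) <;> simp [signMat, one_apply, Pi.single_apply]

theorem signMat_mulVec_inr {R : Type} [CommRing R] (i : Fin n) :
    signMat n R *ᵥ Pi.single (.inr i) 1 = Pi.single (.inr i) 1 := by
  ext (j | j) <;> simp [signMat, one_apply, Pi.single_apply]

/-- Since `S² = 1`, the congruences `ᵗγ ≡ 1` and `ᵗγ S ≡ S` are equivalent. The second says that
`κ_Z` acts on the standard level structure by the prescribed signs, so both implications serve: one
for the compatibility of the standard quadruple, the other for finding `γ` in `Γ(N)`. -/
theorem kappaMat_congr {N : ℕ} {γ : Sp n ℤ} :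
    γ ∈ Gam n N ↔ ∃ P, kappaMat γ = signMat n ℤ + (N : ℤ) • P := by
  rw [mem_Gam_iff]
  constructor
  · rintro ⟨P, hP⟩
    exact ⟨P * signMat n ℤ, by rw [kappaMat, hP, Matrix.add_mul, Matrix.one_mul, smul_mul]⟩
  · rintro ⟨P, hP⟩
    refine ⟨P * signMat n ℤ, ?_⟩
    have := congrArg (· * signMat n ℤ) hP
    simpa only [kappaMat, Matrix.mul_assoc, signMat_mul_self, Matrix.mul_one, Matrix.add_mul,
      smul_mul] using this

theorem toReal_neg {ι : Type*} (w : ι → ℤ) : toReal (-w) = -toReal w := by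
  ext
  simp [toReal]

theorem map_inv_natCast_smul (N : ℕ) (κ : (Fin n → ℂ) →ₗ⋆[ℂ] (Fin n → ℂ)) (v : Fin n → ℂ) :
    κ ((N : ℂ)⁻¹ • v) = (N : ℂ)⁻¹ • κ v := by
  rw [LinearMap.map_smulₛₗ]
  simp

theorem stdQuadruple_isRealPPAVWithLevel {N : ℕ} (hN : 3 ≤ N) {Z : SiegelSpace n} {γ : Sp n ℤ}
    (hγ : γ ∈ Gam n N) (h : γ • Z = tau Z) : (stdQuadruple N γ Z).IsRealPPAVWithLevel N where
  ppav := stdQuadruple_isPPAV N γ Z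
  real := by
    have hinv : Function.Involutive (kappa γ Z) := by
      intro v
      obtain ⟨w, rfl⟩ := (periodEquiv Z).surjective v
      rw [kappa_period_eq_kappaMat h, kappa_period_eq_kappaMat h, mulVec_mulVec, ← Matrix.map_mul,
        kappaMat_mul_self hN hγ h]
      simp
    have hmem : ∀ v ∈ LZ Z, kappa γ Z v ∈ LZ Z := by
      intro v hv
      obtain ⟨w, rfl⟩ := mem_LZ.1 hv
      rw [kappa_period_eq_kappaMat h, ← toReal_mulVec]
      exact periodEquiv_toReal_mem Z _
    refine ⟨hinv, ?_, ?_⟩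
    · refine Set.Subset.antisymm ?_ fun v hv => ⟨kappa γ Z v, hmem v hv, hinv v⟩
      rintro _ ⟨v, hv, rfl⟩
      exact hmem v hv
    · intro u v
      obtain ⟨w, rfl⟩ := (periodEquiv Z).surjective u
      obtain ⟨w', rfl⟩ := (periodEquiv Z).surjective v
      change (HZ Z (kappa γ Z _) (kappa γ Z _)).im = -(HZ Z _ _).im
      rw [kappa_period h, kappa_period h, mulVec_mulVec, mulVec_mulVec, HZ_im_period_mulVec,
        kappaMat_J, HZ_im_period, neg_mulVec, dotProduct_neg]
  level := ⟨stdQuadruple_isTorsionBasis (by omega) γ Z, _, _, stdQuadruple_isLift N γ Z⟩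
  compatible := by
    have key := (congr_iff_mkQ_eq (by omega) Z _ _).2 (kappaMat_congr.1 hγ)
    refine ⟨_, _, stdQuadruple_isLift N γ Z, fun i => ?_, fun i => ?_⟩
    · change (LZ Z).mkQ (kappa γ Z _) = (LZ Z).mkQ _
      rw [map_inv_natCast_smul, periodBasis_apply, kappa_period_eq_kappaMat h,
        periodEquiv_map_mulVec_single, key, signMat_mulVec_inl, toReal_neg, map_neg, smul_neg, toReal_single]
    · change (LZ Z).mkQ (kappa γ Z _) = (LZ Z).mkQ _
      rw [map_inv_natCast_smul, periodBasis_apply, kappa_period_eq_kappaMat h,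
        periodEquiv_map_mulVec_single, key, signMat_mulVec_inr, toReal_single]

/-! ### Isomorphisms of standard quadruples and equivalence under Γ(N) -/

theorem mkQ_map_congr {N : ℕ} (hN : N ≠ 0) {h : Sp n ℤ} (hh : h ∈ Gam n N) (Z : SiegelSpace n)
    (k : Fin n ⊕ Fin n) :
    (LZ Z).mkQ ((N : ℂ)⁻¹ • periodEquiv Z ((spReal h).1ᵀ *ᵥ Pi.single k 1)) =
      (LZ Z).mkQ ((N : ℂ)⁻¹ • periodBasis Z k) := by
  have key := (congr_iff_mkQ_eq hN Z _ _).2 (mem_Gam_iff.1 hh) k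
  rw [one_mulVec, toReal_single, ← periodEquiv_map_mulVec_single, ← periodBasis_apply] at key
  exact key

/-- `ᵗ(C Z + D)` is an isomorphism from the quadruple of `h • Z` to the quadruple of `Z`. -/
theorem exists_isIso_of_smul {N : ℕ} (hN : 3 ≤ N) {h γ γ' : Sp n ℤ} {Z : SiegelSpace n}
    (hh : h ∈ Gam n N) (hγ : γ ∈ Gam n N) (hγ' : γ' ∈ Gam n N) (hZ : γ • Z = tau Z)
    (hZ' : γ' • h • Z = tau (h • Z)) :
    ∃ φ, Quadruple.IsIso N (stdQuadruple N γ' (h • Z)) (stdQuadruple N γ Z) φ := by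
  -- Both elements of `Γ(N)` send `Z` to `τ(h • Z)`, so freeness identifies them. In period
  -- coordinates this is the intertwining of the two real structures.
  have hγγ' : γ' * h = spTau h * γ := by
    refine eq_of_smul_eq hN ((Gam n N).mul_mem hγ' hh) ((Gam n N).mul_mem (spTau_mem_Gam hh) hγ)
      (Z := Z) ?_
    rw [mul_smul, mul_smul, hZ', hZ, tau_smul]
  let φ : (Fin n → ℂ) ≃ₗ[ℂ] (Fin n → ℂ) :=
    LinearEquiv.ofInjectiveEndo (denom (spReal h) Z.mat)ᵀ.mulVecLin <| by
      change Function.Injective (denom (spReal h) Z.mat)ᵀ.mulVec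
      rw [Matrix.mulVec_injective_iff_isUnit, Matrix.isUnit_transpose]
      exact isUnit_denom _ Z
  have hφ : ∀ w, φ (periodEquiv (h • Z) w) = periodEquiv Z ((spReal h).1ᵀ *ᵥ w) :=
    denom_transpose_mulVec_period (spReal h) Z
  refine ⟨φ, ?_, ?_, ?_, _, _, _, _, stdQuadruple_isLift N γ' _, stdQuadruple_isLift N γ Z, ?_, ?_⟩
  · change φ '' (LZ (h • Z) : Set _) = LZ Z
    ext v
    constructor
    · rintro ⟨_, hv, rfl⟩
      obtain ⟨w, rfl⟩ := mem_LZ.1 hv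
      rw [hφ]
      exact mem_LZ.2 ⟨h.1ᵀ *ᵥ w, by rw [toReal_mulVec]; rfl⟩
    · intro hv
      obtain ⟨w, rfl⟩ := mem_LZ.1 hv
      refine ⟨_, periodEquiv_toReal_mem (h • Z) ((h⁻¹).1ᵀ *ᵥ w), ?_⟩
      have e : (spReal h).1ᵀ = (h.1ᵀ).map (Int.castRingHom ℝ) := rfl
      have e' : h.1ᵀ * (h⁻¹).1ᵀ = 1 := by
        rw [← transpose_mul, ← Submonoid.coe_mul, inv_mul_cancel, Submonoid.coe_one,
          transpose_one]
      rw [hφ, e, ← toReal_mulVec, mulVec_mulVec, e', one_mulVec]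
  · refine form_eq_of_im_eq (φ := φ.toLinearMap) fun u v => ?_
    obtain ⟨w, rfl⟩ := (periodEquiv (h • Z)).surjective u
    obtain ⟨w', rfl⟩ := (periodEquiv (h • Z)).surjective v
    change (HZ Z (φ _) (φ _)).im = (HZ (h • Z) _ _).im
    rw [hφ, hφ, HZ_im_period_mulVec, HZ_im_period, transpose_transpose,
      SymplecticGroup.mem_iff.1 (spReal h).2]
  · intro u
    obtain ⟨w, rfl⟩ := (periodEquiv (h • Z)).surjective u
    change φ (kappa γ' (h • Z) _) = kappa γ Z (φ _)
    rw [kappa_period hZ', hφ, hφ, kappa_period hZ]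
    have e := congrArg (fun g : Sp n ℤ => (spReal g).1ᵀ) hγγ'
    simp only [spReal, map_mul, spMap_spTau, Submonoid.coe_mul, spTau_val, transpose_mul,
      signMat_transpose] at e
    rw [mulVec_mulVec, mulVec_mulVec, mulVec_mulVec, mulVec_mulVec, e]
    simp only [Matrix.mul_assoc, signMat_mul_self, Matrix.mul_one]
  · intro i
    rw [map_smul, periodBasis_apply, hφ]
    exact mkQ_map_congr (by omega) hh Z _
  · intro i
    rw [map_smul, periodBasis_apply, hφ]
    exact mkQ_map_congr (by omega) hh Z _

/-- Points with isomorphic quadruples are equivalent under `Γ(N)`. -/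
theorem exists_smul_eq_of_isIso {N : ℕ} (hN : N ≠ 0) {γ γ' : Sp n ℤ} {Z Z' : SiegelSpace n}
    {φ : (Fin n → ℂ) ≃ₗ[ℂ] (Fin n → ℂ)}
    (hφ : Quadruple.IsIso N (stdQuadruple N γ Z) (stdQuadruple N γ' Z') φ) :
    ∃ h ∈ Gam n N, h • Z' = Z := by
  have hL : φ '' (LZ Z : Set (Fin n → ℂ)) = LZ Z' := hφ.map_L
  obtain ⟨M, hM⟩ := exists_int_matrix (Z := Z) (Z' := Z')
    (f := φ.toLinearMap.restrictScalars ℝ) fun k => by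
      change φ (periodBasis Z k) ∈ (LZ Z' : Set (Fin n → ℂ))
      rw [← hL]
      refine ⟨_, ?_, rfl⟩
      rw [← span_periodBasis]
      exact Submodule.subset_span ⟨k, rfl⟩
  replace hM : ∀ w, φ (periodEquiv Z w) = periodEquiv Z' (M.map (Int.castRingHom ℝ) *ᵥ w) := hM
  have hJ : (M.map (Int.castRingHom ℝ))ᵀ * J (Fin n) ℝ * M.map (Int.castRingHom ℝ) =
      J (Fin n) ℝ := by
    ext k l
    have := congrArg Complex.im
      (hφ.map_H (periodEquiv Z (Pi.single k 1)) (periodEquiv Z (Pi.single l 1)))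
    change (HZ Z' _ _).im = (HZ Z _ _).im at this
    rw [hM, hM, HZ_im_period_mulVec, HZ_im_period, neg_inj] at this
    simpa using this
  have hJ' : Mᵀ ∈ symplecticGroup (Fin n) ℤ := by
    rw [SymplecticGroup.mem_iff, transpose_transpose]
    refine Matrix.map_injective (f := Int.castRingHom ℝ) Int.cast_injective ?_
    have e : (J (Fin n) ℤ).map (Int.castRingHom ℝ) = J (Fin n) ℝ := by
      simp [J, fromBlocks_map, Matrix.map_neg]
    beta_reduce
    rw [Matrix.map_mul, Matrix.map_mul, e]
    exact hJ
  obtain ⟨u, v, u', v', hl, hl', hu, hv⟩ := hφ.map_level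
  -- All lifts of a level structure have the same classes modulo the lattice, so the condition
  -- passes from the given lifts to the period bases.
  have hlev : ∀ k, (LZ Z').mkQ (φ ((N : ℂ)⁻¹ • periodBasis Z k)) =
      (LZ Z').mkQ ((N : ℂ)⁻¹ • periodBasis Z' k) := by
    rintro (i | i)
    · refine Eq.trans ((Quadruple.mkQ_map_eq hL).2 ?_) ((hu i).trans ?_)
      · exact ((stdQuadruple_isLift N γ Z).U_eq i).symm.trans (hl.U_eq i)
      · exact (hl'.U_eq i).symm.trans ((stdQuadruple_isLift N γ' Z').U_eq i)
    · refine Eq.trans ((Quadruple.mkQ_map_eq hL).2 ?_) ((hv i).trans ?_)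
      · exact ((stdQuadruple_isLift N γ Z).V_eq i).symm.trans (hl.V_eq i)
      · exact (hl'.V_eq i).symm.trans ((stdQuadruple_isLift N γ' Z').V_eq i)
  refine ⟨⟨Mᵀ, hJ'⟩, ?_, ?_⟩
  · refine mem_Gam_iff.2 ((congr_iff_mkQ_eq hN Z' _ _).1 fun k => ?_)
    rw [transpose_transpose, one_mulVec, toReal_single, ← periodBasis_apply, ← hlev, map_smul φ,
      periodBasis_apply, hM, periodEquiv_map_mulVec_single]
  · exact (smul_eq_of_period (h := spReal ⟨Mᵀ, hJ'⟩) (φ := φ.toLinearMap) hM).1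

/-! ### From a symplectic basis to a point of the Siegel space -/

theorem Quadruple.IsPPAV.linearIndependent_isotropic {A : Quadruple n} (hA : A.IsPPAV)
    {u v : Fin n → Fin n → ℂ} (hb : A.IsSymplecticBasis u v) : LinearIndependent ℂ v := by
  rw [Fintype.linearIndependent_iff]
  intro c hc
  set p := ∑ j, ((c j).re : ℂ) • v j with hp
  set q := ∑ j, ((c j).im : ℂ) • v j with hq
  -- A complex relation among the `v_j` reads `p + iq = 0` with `p`, `q` in their real span, which
  -- is isotropic for `Q`. Then `Re H(p, p) = Im H(q, p) = 0`, so `p = 0` by positivity, whence `q =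
  -- 0`. Pairing with the `u_i` recovers the real coefficients.
  have hpq : p = -(Complex.I • q) := by
    rw [eq_neg_iff_add_eq_zero, ← hc, hp, hq, Finset.smul_sum, ← Finset.sum_add_distrib]
    refine Finset.sum_congr rfl fun j _ => ?_
    rw [smul_smul, ← add_smul]
    congr 1
    rw [mul_comm]
    exact Complex.re_add_im (c j)
  have hvv : ∀ i j, (A.H (v i) (v j)).im = 0 := hb.vv
  have huv : ∀ i j, (A.H (u i) (v j)).im = if i = j then 1 else 0 := hb.uv
  have hqp : (A.H q p).im = 0 := by
    simp only [hp, hq, map_sum, LinearMap.sum_apply, map_smul, LinearMap.smul_apply,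
      LinearMap.map_smulₛₗ, smul_eq_mul, Complex.conj_ofReal, Complex.im_sum,
      Complex.im_ofReal_mul, hvv, mul_zero,
      Finset.sum_const_zero]
  have hpp : (A.H p p).re = 0 := by
    nth_rw 1 [hpq]
    simp [hqp]
  have hp0 : p = 0 := by
    by_contra h
    exact (hA.posDef p h).ne' hpp
  have hq0 : q = 0 := by
    rw [hp0, eq_comm, neg_eq_zero, smul_eq_zero] at hpq
    exact hpq.resolve_left Complex.I_ne_zero
  have e : ∀ (a : Fin n → ℝ) i, (A.H (u i) (∑ j, (a j : ℂ) • v j)).im = a i := by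
    intro a i
    simp only [map_sum, LinearMap.map_smulₛₗ, smul_eq_mul, Complex.conj_ofReal, Complex.im_sum,
      Complex.im_ofReal_mul, huv]
    simp
  intro i
  apply Complex.ext
  · rw [← e (fun j => (c j).re) i]
    change (A.H (u i) p).im = 0
    simp [hp0]
  · rw [← e (fun j => (c j).im) i]
    change (A.H (u i) q).im = 0
    simp [hq0]

/-- A symplectic basis of a principally polarized abelian variety identifies it with the one
attached to a point of the Siegel upper half space. -/
theorem Quadruple.IsPPAV.exists_period {A : Quadruple n} (hA : A.IsPPAV)
    {u v : Fin n → Fin n → ℂ} (hb : A.IsSymplecticBasis u v) :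
    ∃ (Z : SiegelSpace n) (φ : (Fin n → ℂ) ≃ₗ[ℂ] (Fin n → ℂ)),
      (∀ i, φ (u i) = periodBasis Z (.inl i)) ∧ (∀ i, φ (v i) = periodBasis Z (.inr i)) ∧
      ∀ a b, HZ Z (φ a) (φ b) = A.H a b := by
  have hli := hA.linearIndependent_isotropic hb
  let ψ : (Fin n → ℂ) ≃ₗ[ℂ] (Fin n → ℂ) :=
    LinearEquiv.ofInjectiveEndo (Fintype.linearCombination ℂ v)
      ((injective_iff_map_eq_zero _).2 fun c hc =>
        funext (Fintype.linearIndependent_iff.1 hli c hc))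
  have hψ : ∀ a, ψ a = ∑ i, a i • v i := fun a => Fintype.linearCombination_apply ℂ v a
  have hψs : ∀ i, ψ (Pi.single i 1) = v i := fun i => by
    rw [hψ]
    simp [Pi.single_apply]
  -- The Gram matrix of `H` in the complex basis `v` is real because `Q` vanishes on the `v_j`; it
  -- will turn out to be `(Im Z)⁻¹`.
  set T : Matrix (Fin n) (Fin n) ℝ := Matrix.of fun i j => (A.H (v i) (v j)).re with hT
  have hvT : ∀ i j, A.H (v i) (v j) = (T i j : ℂ) := fun i j =>
    Complex.ext (by simp [hT]) (hb.vv i j)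
  have hH : ∀ a b, A.H (ψ a) (ψ b) = a ⬝ᵥ (T.map Complex.ofReal *ᵥ star b) := by
    intro a b
    rw [hψ, hψ]
    simp only [map_sum, LinearMap.sum_apply, map_smul, LinearMap.smul_apply, LinearMap.map_smulₛₗ,
      hvT, dotProduct, mulVec, Matrix.map_apply, smul_eq_mul, Finset.mul_sum, Pi.star_apply]
    rw [Finset.sum_comm]
    refine Finset.sum_congr rfl fun i _ => Finset.sum_congr rfl fun j _ => ?_
    rw [starRingEnd_apply]
    ring
  have hTs : ∀ i j, T j i = T i j := fun i j => by
    have := hA.hermitian (v i) (v j)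
    rw [hvT, hvT, Complex.conj_ofReal] at this
    exact_mod_cast this
  have hTt : Tᵀ = T := Matrix.ext fun i j => hTs i j
  have hTp : T.PosDef := by
    refine PosDef.of_dotProduct_mulVec_pos (Matrix.ext fun i j => by simp [hTs]) fun x hx => ?_
    have hx' : (fun i => (x i : ℂ)) ≠ 0 := fun h0 => hx <| by
      ext i
      simpa using congrFun h0 i
    have h1 := hA.posDef (ψ fun i => (x i : ℂ)) (by simpa using hx')
    have h2 : star (fun i => (x i : ℂ)) = fun i => (x i : ℂ) := by
      ext i
      simp
    rw [hH, h2, ofReal_mulVec, ofReal_dotProduct, Complex.ofReal_re] at h1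
    simpa using h1
  have hTu : IsUnit T.det := (Matrix.isUnit_iff_isUnit_det _).1 hTp.isUnit
  -- The columns of the period matrix are the coordinates of the `u_i` in the basis `v`. The
  -- relations `Q(u_i, v_j) = δ_ij` give `ᵗY T = 1`, and `Q(u_i, u_j) = 0` then makes the real part
  -- symmetric.
  set Zm : Matrix (Fin n) (Fin n) ℂ := Matrix.of fun j i => ψ.symm (u i) j with hZm
  set Xm := Zm.map Complex.re with hXm
  set Y := Zm.map Complex.im with hY
  have hYT : Yᵀ * T = 1 := by
    ext i j
    have h1 := hb.uv i j
    change (A.H (u i) (v j)).im = _ at h1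
    rw [← ψ.apply_symm_apply (u i), ← hψs, hH, sesquilinear_im] at h1
    have h2 : (fun k => ((Pi.single j 1 : Fin n → ℂ) k).re) = Pi.single j 1 := by
      ext k
      simp [Pi.single_apply, apply_ite Complex.re]
    have h3 : (fun k => ((Pi.single j 1 : Fin n → ℂ) k).im) = 0 := by
      ext k
      simp [Pi.single_apply, apply_ite Complex.im]
    rw [h2, h3, mulVec_zero, dotProduct_zero, sub_zero, mulVec_single_one] at h1
    rw [one_apply, ← h1]
    rfl
  have hYT' : Y = T⁻¹ := by
    have h1 : Yᵀ = T⁻¹ := (Matrix.inv_eq_left_inv hYT).symm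
    rw [← transpose_transpose Y, h1, transpose_nonsing_inv, hTt]
  have hTY : T * Y = 1 := by rw [hYT', mul_nonsing_inv _ hTu]
  have hX : Xmᵀ = Xm := by
    ext i j
    have h1 := hb.uu i j
    change (A.H (u i) (u j)).im = _ at h1
    rw [← ψ.apply_symm_apply (u i), ← ψ.apply_symm_apply (u j), hH, sesquilinear_im] at h1
    have h2 : (Yᵀ * (T * Xm) - Xmᵀ * (T * Y)) i j = 0 := h1
    rw [← Matrix.mul_assoc, hYT, hTY, Matrix.one_mul, Matrix.mul_one, Matrix.sub_apply] at h2
    linarith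
  have hYt : Yᵀ = Y := by rw [hYT', transpose_nonsing_inv, hTt]
  let Z : SiegelSpace n := ⟨Zm, Matrix.ext fun i j => Complex.ext
    (congrFun (congrFun hX i) j) (congrFun (congrFun hYt i) j), by
      change Y.PosDef
      rw [hYT']
      exact hTp.inv⟩
  refine ⟨Z, ψ.symm, fun i => ?_, fun i => ?_, fun a b => ?_⟩
  · rw [periodBasis_apply, periodEquiv_apply, FZ]
    ext j
    simp [mulVec, dotProduct, Pi.single_apply, Z, hZm, apply_ite Complex.ofReal]
  · rw [← hψs, LinearEquiv.symm_apply_apply, periodBasis_apply, periodEquiv_apply, FZ]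
    ext j
    simp [mulVec, dotProduct, Pi.single_apply, apply_ite Complex.ofReal]
  · have h1 : (Z.mat.map Complex.im)⁻¹ = T := by
      change Y⁻¹ = T
      rw [hYT', nonsing_inv_nonsing_inv _ hTu]
    rw [HZ_apply, h1, ← hH, LinearEquiv.apply_symm_apply, LinearEquiv.apply_symm_apply]

/-! ### Surjectivity: recovering γ from the real structure -/

/-- Every real principally polarized abelian variety with level structure is isomorphic to the
quadruple of a real point. -/
theorem exists_isIso_stdQuadruple {N : ℕ} (hN : N ≠ 0) {A : Quadruple n}
    (hA : A.IsRealPPAVWithLevel N) :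
    ∃ (Z : SiegelSpace n) (γ : Sp n ℤ), γ ∈ Gam n N ∧ γ • Z = tau Z ∧
      ∃ φ, Quadruple.IsIso N (stdQuadruple N γ Z) A φ := by
  obtain ⟨u, v, hl, hu, hv⟩ := hA.compatible
  obtain ⟨Z, φ, hφu, hφv, hφH⟩ := hA.ppav.exists_period hl.basis
  have hφk : ∀ k, φ (Sum.elim u v k) = periodBasis Z k := by
    rintro (i | i)
    · exact hφu i
    · exact hφv i
  have hL : φ '' (A.L : Set (Fin n → ℂ)) = LZ Z := by
    rw [← hl.basis.span_eq, ← span_periodBasis]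
    have h1 := Submodule.map_span (φ.toLinearMap.restrictScalars ℤ) (Set.range (Sum.elim u v))
    rw [← Set.range_comp] at h1
    have h2 : (φ.toLinearMap.restrictScalars ℤ) ∘ Sum.elim u v = periodBasis Z := funext hφk
    rw [h2] at h1
    rw [← h1]
    rfl
  -- The real structure is transported along `φ`, so that its matrix can be taken in the periods of
  -- `Z`.
  let κ : (Fin n → ℂ) →ₗ⋆[ℂ] (Fin n → ℂ) :=
    (φ.toLinearMap.comp A.κ).comp φ.symm.toLinearMap
  have hκ : ∀ a, φ (A.κ a) = κ (φ a) := fun a => by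
    change _ = φ (A.κ (φ.symm (φ a)))
    rw [LinearEquiv.symm_apply_apply]
  let κR : (Fin n → ℂ) →ₗ[ℝ] (Fin n → ℂ) :=
    { toFun := κ
      map_add' := map_add κ
      map_smul' := fun c a => by
        change κ ((c : ℂ) • a) = (c : ℂ) • κ a
        rw [LinearMap.map_smulₛₗ, Complex.conj_ofReal] }
  obtain ⟨M, hM⟩ := exists_int_matrix (Z := Z) (Z' := Z) (f := κR) fun k => by
    change κ (periodBasis Z k) ∈ (LZ Z : Set (Fin n → ℂ))
    rw [← hφk, ← hκ, ← hL]
    refine ⟨_, ?_, rfl⟩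
    rw [← hA.real.map_lattice]
    refine ⟨_, ?_, rfl⟩
    rw [← hl.basis.span_eq]
    exact Submodule.subset_span ⟨k, rfl⟩
  replace hM : ∀ w, κ (periodEquiv Z w) = periodEquiv Z (M.map (Int.castRingHom ℝ) *ᵥ w) := hM
  have hJ : (M.map (Int.castRingHom ℝ))ᵀ * J (Fin n) ℝ * M.map (Int.castRingHom ℝ) =
      -J (Fin n) ℝ := by
    have hQ : ∀ a b, (HZ Z (κ a) (κ b)).im = -(HZ Z a b).im := by
      intro a b
      obtain ⟨a, rfl⟩ := φ.surjective a
      obtain ⟨b, rfl⟩ := φ.surjective b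
      rw [← hκ, ← hκ, hφH, hφH]
      exact hA.real.compatible a b
    ext k l
    have := hQ (periodEquiv Z (Pi.single k 1)) (periodEquiv Z (Pi.single l 1))
    rw [hM, hM, HZ_im_period_mulVec, HZ_im_period, neg_inj] at this
    simpa using this
  have hJZ : Mᵀ * J (Fin n) ℤ * M = -J (Fin n) ℤ := by
    refine Matrix.map_injective (f := Int.castRingHom ℝ) Int.cast_injective ?_
    have e : (J (Fin n) ℤ).map (Int.castRingHom ℝ) = J (Fin n) ℝ := by
      simp [J, fromBlocks_map, Matrix.map_neg]
    have e' : (-J (Fin n) ℤ).map (Int.castRingHom ℝ) = -J (Fin n) ℝ := by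
      rw [← e]
      ext i j
      simp
    beta_reduce
    rw [Matrix.map_mul, Matrix.map_mul, e, e']
    exact hJ
  -- Solving `ᵗγ S = M` gives `γ = S ᵗM`. Both `M` and `S` reverse `J`, so the two signs cancel.
  have hmem : signMat n ℤ * Mᵀ ∈ symplecticGroup (Fin n) ℤ := by
    rw [SymplecticGroup.mem_iff, transpose_mul, transpose_transpose, signMat_transpose]
    have : signMat n ℤ * Mᵀ * J (Fin n) ℤ * (M * signMat n ℤ) =
        signMat n ℤ * (Mᵀ * J (Fin n) ℤ * M) * signMat n ℤ := by
      simp only [Matrix.mul_assoc]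
    rw [this, hJZ, Matrix.mul_neg, Matrix.neg_mul, signMat_mul_J_mul, neg_neg]
  let γ : Sp n ℤ := ⟨signMat n ℤ * Mᵀ, hmem⟩
  have hγM : kappaMat γ = M := by
    change (signMat n ℤ * Mᵀ)ᵀ * signMat n ℤ = M
    rw [transpose_mul, transpose_transpose, signMat_transpose, Matrix.mul_assoc,
      signMat_mul_self, Matrix.mul_one]
  obtain ⟨hγZ, hκγ⟩ := eq_kappa_of_period (γ := γ) (Z := Z) (κ := κ) fun w => by
    rw [hM, ← hγM, Matrix.map_mul, signMat_map, mulVec_mulVec]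
    rfl
  -- Compatibility of the lift says that `κ` acts on the `N`-torsion as `S`, that is `M ≡ S` modulo
  -- `N`.
  have hlev : ∀ k, (LZ Z).mkQ (κ ((N : ℂ)⁻¹ • periodBasis Z k)) =
      (LZ Z).mkQ ((N : ℂ)⁻¹ • periodEquiv Z (toReal (signMat n ℤ *ᵥ Pi.single k 1))) := by
    rintro (i | i)
    · rw [signMat_mulVec_inl, toReal_neg, toReal_single, map_neg, ← periodBasis_apply, ← hφk,
        ← map_neg, ← map_smul, ← map_smul, ← hκ, Quadruple.mkQ_map_eq hL, smul_neg]
      exact hu i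
    · rw [signMat_mulVec_inr, toReal_single, ← periodBasis_apply, ← hφk, ← map_smul, ← hκ,
        Quadruple.mkQ_map_eq hL]
      exact hv i
  have hγ : γ ∈ Gam n N := by
    refine kappaMat_congr.2 ((congr_iff_mkQ_eq hN Z _ _).1 fun k => ?_)
    rw [← hlev, map_inv_natCast_smul, periodBasis_apply, hM, hγM, periodEquiv_map_mulVec_single]
  refine ⟨Z, γ, hγ, hγZ, φ.symm, Quadruple.IsIso.symm ⟨hL, hφH, fun a => ?_, u, v, _, _, hl,
    stdQuadruple_isLift N γ Z, fun i => ?_, fun i => ?_⟩⟩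
  · rw [hκ, hκγ]
    rfl
  · rw [map_smul, hφu]
  · rw [map_smul, hφv]

/-! ### The map on real points and the final assembly -/

/-- The quadruple of a real point, for a chosen representative. -/
noncomputable def realPointQuadruple {N : ℕ} (hN : 3 ≤ N) (x : XR n N) : RealPPAV n N :=
  have h : ∃ p : SiegelSpace n × Sp n ℤ, toX N p.1 = x.1 ∧ p.2 ∈ Gam n N ∧ p.2 • p.1 = tau p.1 := by
    obtain ⟨x, hx⟩ := x
    induction x using Quotient.inductionOn with | h Z
    obtain ⟨γ, h1, h2⟩ := mem_XR_iff.1 hx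
    exact ⟨(Z, γ), rfl, h1, h2⟩
  ⟨stdQuadruple N h.choose.2 h.choose.1,
    stdQuadruple_isRealPPAVWithLevel hN h.choose_spec.2.1 h.choose_spec.2.2⟩

theorem realPointQuadruple_spec {N : ℕ} (hN : 3 ≤ N) (x : XR n N) :
    ∃ (Z : SiegelSpace n) (γ : Sp n ℤ), toX N Z = x.1 ∧ γ ∈ Gam n N ∧ γ • Z = tau Z ∧
      (realPointQuadruple hN x).1 = stdQuadruple N γ Z := by
  refine ⟨_, _, ?_, ?_, ?_, rfl⟩
  all_goals generalize_proofs h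
  exacts [h.choose_spec.1, h.choose_spec.2.1, h.choose_spec.2.2]

theorem exists_isIso_of_toX_eq {N : ℕ} (hN : 3 ≤ N) {γ γ' : Sp n ℤ} {Z Z' : SiegelSpace n}
    (hγ : γ ∈ Gam n N) (hγ' : γ' ∈ Gam n N) (hZ : γ • Z = tau Z) (hZ' : γ' • Z' = tau Z')
    (e : toX N Z' = toX N Z) :
    ∃ φ, Quadruple.IsIso N (stdQuadruple N γ' Z') (stdQuadruple N γ Z) φ := by
  obtain ⟨h, rfl⟩ := Quotient.exact e
  exact exists_isIso_of_smul hN h.2 hγ hγ' hZ hZ'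

end RealAV

open RealAV
theorem mainTheorem2 (n m : ℕ) (hm : 1 ≤ m) :
    (∀ Z : SiegelSpace n, toX (4 * m) Z ∈ XR n (4 * m) →
      ∃! γ : Sp n ℤ, γ ∈ Gam n (4 * m) ∧ γ • Z = tau Z) ∧
    (∀ (Z : SiegelSpace n) (γ : Sp n ℤ), γ ∈ Gam n (4 * m) → γ • Z = tau Z →
      (stdQuadruple (4 * m) γ Z).IsRealPPAVWithLevel (4 * m)) ∧
    ∃ Φ : XR n (4 * m) → IsoClasses n (4 * m),
      Function.Bijective Φ ∧
      ∀ (Z : SiegelSpace n) (hZ : toX (4 * m) Z ∈ XR n (4 * m)) (γ : Sp n ℤ),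
        γ ∈ Gam n (4 * m) → γ • Z = tau Z →
        ∀ hA : (stdQuadruple (4 * m) γ Z).IsRealPPAVWithLevel (4 * m),
          Φ ⟨toX (4 * m) Z, hZ⟩ = Quotient.mk _ ⟨stdQuadruple (4 * m) γ Z, hA⟩ := by
  have hN : 3 ≤ 4 * m := by omega
  have hN0 : 4 * m ≠ 0 := by omega
  -- The isomorphism class does not depend on the chosen representative; this is the
  -- well-definedness of the map, and surjectivity uses it again.
  have hΦ : ∀ (Z : SiegelSpace n) (hZ : toX (4 * m) Z ∈ XR n (4 * m)) (γ : Sp n ℤ),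
      γ ∈ Gam n (4 * m) → γ • Z = tau Z →
      ∀ hA : (stdQuadruple (4 * m) γ Z).IsRealPPAVWithLevel (4 * m),
        (Quotient.mk _ (realPointQuadruple hN ⟨toX (4 * m) Z, hZ⟩) : IsoClasses n (4 * m)) =
          Quotient.mk _ ⟨stdQuadruple (4 * m) γ Z, hA⟩ := by
    intro Z hZ γ hγ hγZ hA
    obtain ⟨Z', γ', h1, h2, h3, h4⟩ := realPointQuadruple_spec hN ⟨toX (4 * m) Z, hZ⟩
    refine Quotient.sound ?_
    change ∃ φ, Quadruple.IsIso (4 * m) (realPointQuadruple hN _).1 _ φ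
    rw [h4]
    exact exists_isIso_of_toX_eq hN hγ h2 hγZ h3 h1
  refine ⟨fun Z hZ => ?_, fun Z γ hγ h => stdQuadruple_isRealPPAVWithLevel hN hγ h,
    fun x => Quotient.mk _ (realPointQuadruple hN x), ⟨fun x y hxy => ?_, fun a => ?_⟩, hΦ⟩
  · obtain ⟨γ, h1, h2⟩ := mem_XR_iff.1 hZ
    exact ⟨γ, ⟨h1, h2⟩, fun γ' h' => eq_of_smul_eq hN h'.1 h1 (h'.2.trans h2.symm)⟩
  · obtain ⟨Z, γ, h1, -, -, h4⟩ := realPointQuadruple_spec hN x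
    obtain ⟨Z', γ', h1', -, -, h4'⟩ := realPointQuadruple_spec hN y
    obtain ⟨φ, hφ⟩ := Quotient.exact hxy
    rw [h4, h4'] at hφ
    obtain ⟨h, hh, hZ⟩ := exists_smul_eq_of_isIso hN0 hφ
    apply Subtype.ext
    rw [← h1, ← h1']
    exact Quotient.sound ⟨⟨h, hh⟩, hZ⟩
  · induction a using Quotient.inductionOn with | h A
    obtain ⟨Z, γ, hγ, hZ, hφ⟩ := exists_isIso_stdQuadruple hN0 A.2
    refine ⟨⟨toX (4 * m) Z, mem_XR_iff.2 ⟨γ, hγ, hZ⟩⟩, ?_⟩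
    exact (hΦ Z _ γ hγ hZ (stdQuadruple_isRealPPAVWithLevel hN hγ hZ)).trans (Quotient.sound hφ)
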